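/- **Setting.** A network has $N\ge 1$ agents. Agent $k$ has a cost $J_k:\mathbb R^M\to\mathbb R$ and the constraint set $\mathbb W_k=\{w: h_{k,u}(w)=0\ (u\le U_k),\ g_{k,l}(w)\le 0\ (l\le L_k)\}$ with $h_{k,u}$ affine and $g_{k,l}:\mathbb R^M\to\mathbb R$ convex; $\mathbb W=\bigcap_k\mathbb W_k$. Let $\delta^{\rm IP},\delta^{\rm EP}:\mathbb R\to\mathbb R$ be continuous convex functions such that $\delta^{\rm IP}(x)=0$ for $x\le 0$, $\delta^{\rm IP}(x)>0$ for $x>0$, $\delta^{\rm EP}(0)=0$, $\delta^{\rm EP}(x)>0$ for $x\ne0$, and let $p_k(w)=\sum_l\delta^{\rm IP}(g_{k,l}(w))+\sum_u\delta^{\rm EP}(h_{k,u}(w))$ be the penalty of agent $k$. For $\eta\ge0$ let $w^o(\eta)$ be the (unique) minimizer over $\mathbb R^M$ of $\sum_kJ_k(w)+\eta\sum_kp_k(w)$; if $\mathbb W\neq\emptyset$, let $w^\star$ be the (unique) minimizer of $\sum_kJ_k$ over $\mathbb W$. **Assumptions.** (i) Each $J_k$ is twice differentiable and $\lambda_{k,\min}I\le\nabla^2J_k(w)\le\lambda_{k,\max}I$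 for all $w$, with $\lambda_{k,\min},\lambda_{k,\max}>0$. (ii) Each $p_k$ is twice differentiable and $\nabla^2p_k(w)\le\lambda^p_{k,\max}I$ for all $w$, with $\lambda_{k,\max}^p>0$. (iii) $A=[a_{\ell k}]$ is a primitive doubly stochastic $N\times N$ matrix, and either $(A_1,A_2)=(I,A)$ (adapt-then-combine, ATC) or $(A_1,A_2)=(A,I)$ (combine-then-adapt, CTA). (iv) For a step-size $\mu>0$ and $\eta>0$ the iterates are, for $i\ge1$, $$\phi_{k,i-1}=\sum_\ell a_{1,\ell k}w_{\ell,i-1},\quad \zeta_{k,i}=\phi_{k,i-1}-\mu\big(\nabla J_k(\phi_{k,i-1})+v_{k,i}(\phi_{k,i-1})\big),$$ $$\psi_{k,i}=\zeta_{k,i}-\mu\eta\nabla p_k(\zeta_{k,i}),\quad w_{k,i}=\sum_\ell a_{2,\ell k}\psi_{\ell,i},$$ with square-integrable random initial vectors $w_{k,0}$ and gradient noise $v_{k,i}(\cdot)$ such that, with $\mathcal H_{i-1}=\sigma(w_{k,j}: j\le i-1,\ \text{all }k)$, for every square-integrable $\mathcal H_{i-1}$-measurable random vector $y$ one has $\mathbb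 E[v_{k,i}(y)\mid\mathcal H_{i-1}]=0$ and $\mathbb E\|v_{k,i}(y)\|^2\le\alpha\,\mathbb E\|y\|^2+\sigma_v^2$, where $\alpha,\sigma_v^2\ge0$ are fixed. **Theorem.** Put $$\mu_{\max}(\eta)=\min_{1\le k\le N}\Big\{\frac{2\lambda_{k,\max}}{\lambda_{k,\max}^2+2\alpha},\ \frac{2\lambda_{k,\min}}{\lambda_{k,\min}^2+2\alpha},\ \frac{2}{\eta\lambda^p_{k,\max}}\Big\}.$$ Then, with $w^o(\eta)$ existing and unique for every $\eta\ge0$: 1. For $\eta>0$ and $0<\mu<\mu_{\max}(\eta)$ the diffusion strategy converges: the noise-free recursion ($v\equiv0$) has a unique fixed point, to which it converges from every initial point, and the stochastic recursion is mean-square stable, $\limsup_{i\to\infty}\mathbb E\|w^o(\eta)-w_{k,i}\|^2<\infty$ for all $k$. 2. For every $\eta>0$ and $\rho\in(0,1)$ there are constants $C_1,C_2$, independent of $\mu$, of the noise and of the initial vectors (they depend only on the costs, the penalties, $A_1,A_2$, $\alpha$, $\sigma_v^2$, $\rho$ and $\eta$), such that for all $0<\mu\le\rho\,\mu_{\max}(\eta)$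 and all $k$ $$\limsup_{i\to\infty}\mathbb E\|w^o(\eta)-w_{k,i}\|^2\le C_1\mu+C_2(\eta\mu)^2 .$$ If the problem is feasible ($\mathbb W\ne\emptyset$), then $C_1,C_2$ can be chosen independent of $\eta>0$ as well. 3. For every fixed $\eta>0$, $\lim_{\mu\to0^+}\limsup_{i\to\infty}\mathbb E\|w^o(\eta)-w_{k,i}\|^2=0$ for all $k$. 4. If $\mathbb W\neq\emptyset$, then $w^\star$ exists and is unique, and for every $0<\theta<1$, with $\eta=\mu^{-\theta}$, $\lim_{\mu\to0^+}\limsup_{i\to\infty}\mathbb E\|w^\star-w_{k,i}\|^2=0$ for all $k$. -/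

import Mathlib

open Filter Topology MeasureTheory
open scoped ENNReal

universe u

noncomputable section

/-! ### The constrained network problem and its penalized form -/

/-- The gradient map of `f`. -/
abbrev grad {M : ℕ} (f : EuclideanSpace ℝ (Fin M) → ℝ) :
    EuclideanSpace ℝ (Fin M) → EuclideanSpace ℝ (Fin M) := gradient f

/-- The Hessian of `f` at `x`, as the linear map `u ↦ ∇²f(x) u`. -/
def hessian {M : ℕ} (f : EuclideanSpace ℝ (Fin M) → ℝ) (x : EuclideanSpace ℝ (Fin M)) :
    EuclideanSpace ℝ (Fin M) →L[ℝ] EuclideanSpace ℝ (Fin M) := fderiv ℝ (grad f) x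

/-- `f` has a Hessian at every point. -/
def TwiceDifferentiable {M : ℕ} (f : EuclideanSpace ℝ (Fin M) → ℝ) : Prop :=
  Differentiable ℝ f ∧ Differentiable ℝ (grad f)

/-- `∇²f(x) ≥ a I` for every `x`. -/
def HessianGE {M : ℕ} (f : EuclideanSpace ℝ (Fin M) → ℝ) (a : ℝ) : Prop :=
  ∀ x u : EuclideanSpace ℝ (Fin M), a * ‖u‖ ^ 2 ≤ inner ℝ u (hessian f x u)

/-- `∇²f(x) ≤ b I` for every `x`. -/
def HessianLE {M : ℕ} (f : EuclideanSpace ℝ (Fin M) → ℝ) (b : ℝ) : Prop :=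
  ∀ x u : EuclideanSpace ℝ (Fin M), inner ℝ u (hessian f x u) ≤ b * ‖u‖ ^ 2

/-- A penalty function for constraints `x ≤ 0`: continuous, convex, zero for `x ≤ 0` and positive
for `x > 0`. -/
structure IsInequalityPenalty (δ : ℝ → ℝ) : Prop where
  continuous : Continuous δ
  convex : ConvexOn ℝ Set.univ δ
  zero_of_nonpos : ∀ x, x ≤ 0 → δ x = 0
  pos_of_pos : ∀ x, 0 < x → 0 < δ x

/-- A penalty function for constraints `x = 0`: continuous, convex, zero at `0` and positive
elsewhere. -/
structure IsEqualityPenalty (δ : ℝ → ℝ) : Prop where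
  continuous : Continuous δ
  convex : ConvexOn ℝ Set.univ δ
  zero_at_zero : δ 0 = 0
  pos_of_ne : ∀ x, x ≠ 0 → 0 < δ x

/-- The penalty function `p_k` of an agent with inequality constraints `g l ≤ 0` and affine
equality constraints `h u = 0`. -/
def penalty {M L U : ℕ} (δIP δEP : ℝ → ℝ) (g : Fin L → EuclideanSpace ℝ (Fin M) → ℝ)
    (h : Fin U → EuclideanSpace ℝ (Fin M) →ᵃ[ℝ] ℝ) (w : EuclideanSpace ℝ (Fin M)) : ℝ :=
  ∑ l, δIP (g l w) + ∑ j, δEP (h j w)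

/-- The constraint set `𝕎_k` of one agent. -/
def constraintSet {M L U : ℕ} (g : Fin L → EuclideanSpace ℝ (Fin M) → ℝ)
    (h : Fin U → EuclideanSpace ℝ (Fin M) →ᵃ[ℝ] ℝ) : Set (EuclideanSpace ℝ (Fin M)) :=
  {w | (∀ j, h j w = 0) ∧ ∀ l, g l w ≤ 0}

/-- The aggregate cost `J^glob`. -/
def aggregateCost {K : Type*} [Fintype K] {M : ℕ} (J : K → EuclideanSpace ℝ (Fin M) → ℝ)
    (w : EuclideanSpace ℝ (Fin M)) : ℝ := ∑ k, J k w

/-- The penalized aggregate cost `J^glob_η`. -/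
def penalizedCost {K : Type*} [Fintype K] {M : ℕ} (J p : K → EuclideanSpace ℝ (Fin M) → ℝ)
    (η : ℝ) (w : EuclideanSpace ℝ (Fin M)) : ℝ := ∑ k, J k w + η * ∑ k, p k w

/-! ### The penalized diffusion strategy -/

/-- The combination step `x ↦ (∑ ℓ, b_{ℓk} x_ℓ)_k`. -/
def combine {K : Type*} [Fintype K] {M : ℕ} (B : Matrix K K ℝ)
    (x : K → EuclideanSpace ℝ (Fin M)) : K → EuclideanSpace ℝ (Fin M) :=
  fun k => ∑ l, B l k • x l

/-- One iteration of the diffusion strategy when the perturbation of the gradient of agent `k` at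
the point `y` is `n k y`: combine with `A₁`, move against the perturbed gradient of the cost, move
against the gradient of the penalty, combine with `A₂`. -/
def diffusionStep {K : Type*} [Fintype K] {M : ℕ} (J p : K → EuclideanSpace ℝ (Fin M) → ℝ)
    (A₁ A₂ : Matrix K K ℝ) (μ η : ℝ)
    (n : K → EuclideanSpace ℝ (Fin M) → EuclideanSpace ℝ (Fin M))
    (x : K → EuclideanSpace ℝ (Fin M)) : K → EuclideanSpace ℝ (Fin M) :=
  let φ := combine A₁ x
  let ζ := fun k => φ k - μ • (grad (J k) (φ k) + n k (φ k))
  let ψ := fun k => ζ k - (μ * η) • grad (p k) (ζ k)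
  combine A₂ ψ

/-- The past history of the iterates: the σ-algebra generated by `w_{k,j}`, `j ≤ i`, all `k`. -/
@[reducible] def history {K : Type*} {Ω : Type*} {M : ℕ} (w : ℕ → K → Ω → EuclideanSpace ℝ (Fin M)) (i : ℕ) :
    MeasurableSpace Ω :=
  ⨆ (j : ℕ) (_ : j ≤ i) (k : K), MeasurableSpace.comap (w j k) inferInstance

/-- The gradient-noise model: for every point `y` that is determined by the iterates up to time `i`
and has a finite second moment, the noise `v_{k,i+1}(y)` is a random vector with finite second
moment, with `𝔼{v_{k,i+1}(y) | history up to i} = 0` and `𝔼‖v_{k,i+1}(y)‖² ≤ α 𝔼‖y‖² + σ²`. -/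
def IsGradientNoise {K : Type*} {Ω : Type*} [MeasurableSpace Ω] {M : ℕ} (P : Measure Ω)
    (w : ℕ → K → Ω → EuclideanSpace ℝ (Fin M))
    (v : ℕ → K → EuclideanSpace ℝ (Fin M) → Ω → EuclideanSpace ℝ (Fin M)) (α σ : ℝ) : Prop :=
  ∀ (i : ℕ) (k : K) (y : Ω → EuclideanSpace ℝ (Fin M)), Measurable[history w i] y → MemLp y 2 P →
    Measurable (fun ω => v (i + 1) k (y ω) ω) ∧
    MemLp (fun ω => v (i + 1) k (y ω) ω) 2 P ∧
    P[fun ω => v (i + 1) k (y ω) ω | history w i] =ᵐ[P] 0 ∧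
    ∫ ω, ‖v (i + 1) k (y ω) ω‖ ^ 2 ∂P ≤ α * ∫ ω, ‖y ω‖ ^ 2 ∂P + σ ^ 2

/-- A run of the stochastic diffusion strategy with step-size `μ` and penalty parameter `η`, on an
arbitrary probability space, with arbitrary square-integrable initial iterates and with gradient
noise `v_{k,i}` of parameters `α` and `σ`. -/
structure DiffusionRun {K : Type*} [Fintype K] {M : ℕ} (J p : K → EuclideanSpace ℝ (Fin M) → ℝ)
    (A₁ A₂ : Matrix K K ℝ) (α σ μ η : ℝ) where
  Ω : Type u
  [mΩ : MeasurableSpace Ω]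
  P : Measure Ω
  [prob : IsProbabilityMeasure P]
  v : ℕ → K → EuclideanSpace ℝ (Fin M) → Ω → EuclideanSpace ℝ (Fin M)
  w : ℕ → K → Ω → EuclideanSpace ℝ (Fin M)
  init_measurable : ∀ k, Measurable (w 0 k)
  init_memLp : ∀ k, MemLp (w 0 k) 2 P
  noise : IsGradientNoise P w v α σ
  recursion : ∀ i ω, (fun k => w (i + 1) k ω) =
    diffusionStep J p A₁ A₂ μ η (fun k y => v (i + 1) k y ω) (fun k => w i k ω)

/-- `limsup_{i → ∞} 𝔼‖z - w_{k,i}‖²`, as an extended nonnegative real number. -/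
def DiffusionRun.limsupMSE {K : Type*} [Fintype K] {M : ℕ}
    {J p : K → EuclideanSpace ℝ (Fin M) → ℝ} {A₁ A₂ : Matrix K K ℝ} {α σ μ η : ℝ}
    (R : DiffusionRun.{u} J p A₁ A₂ α σ μ η) (z : EuclideanSpace ℝ (Fin M)) (k : K) : ℝ≥0∞ :=
  letI : MeasurableSpace R.Ω := R.mΩ
  limsup (fun i : ℕ => ∫⁻ ω, ‖z - R.w i k ω‖ₑ ^ 2 ∂(R.P)) atTop

/-- The step-size threshold
`min_k min {2 λ_{k,max} / (λ_{k,max}² + 2α), 2 λ_{k,min} / (λ_{k,min}² + 2α), 2 / (η λ^p_{k,max})}`. -/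
def stepThreshold {K : Type*} [Fintype K] [Nonempty K] (lmin lmax lp : K → ℝ) (α η : ℝ) : ℝ :=
  Finset.univ.inf' Finset.univ_nonempty fun k =>
    min (2 * lmax k / (lmax k ^ 2 + 2 * α))
      (min (2 * lmin k / (lmin k ^ 2 + 2 * α)) (2 / (η * lp k)))

end

/-!
One iteration applies, at each agent, a gradient step on the cost, a gradient step on the penalty,
and an average over the network. Below the threshold the first is a contraction (its derivative
`I - μ ∇²J` is symmetric with spectrum inside `(-1, 1)`), the second is nonexpansive because
`η μ λᵖ ≤ 2`, and averaging with a doubly stochastic matrix is nonexpansive, both in the supremum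
norm over the agents and for the sum of squares. Hence the noise-free recursion has a unique
attracting fixed point (`exists_fixedPoint_diffusionStep`). The noise is orthogonal to the past, so the
mean-square distance to that fixed point contracts by `(1 - μ λ)² + 2 α μ² ≤ 1 - c μ` per iteration
up to an error of order `μ²`, which leaves a steady-state error of order `μ`
(`DiffusionRun.limsupMSE_le`).

What remains is the distance from the fixed point to the minimizer `wo` of the penalized cost
(`exists_bias_bound`). If `φ_k` are the points at which the agents evaluate the gradients of their
costs and `ζ_k` those at which they evaluate the gradients of their penalties, then summing the
fixed-point equation over the network gives `∑ (∇J_k(φ_k) + η ∇p_k(ζ_k)) = 0`, while the `φ_k` differ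
from their mean by at most a multiple of the step just made, as the combination matrix is primitive
(`exists_norm_sub_networkMean_le`). Testing that equation with the difference of the mean and `wo`,
strong monotonicity of `∇J_k` yields the squared distance to `wo`, and cocoercivity of `∇p_k` yields
`η ∑ ‖∇p_k(ζ_k) - ∇p_k(wo)‖²`. The weight `η` of that second term suffices to absorb all errors
caused by the large penalty gradients, provided that `η ‖∇p_k(wo)‖²` is bounded. For fixed `η` this is
trivial. For a feasible problem it holds uniformly in `η`, although `η ‖∇p_k(wo)‖` itself may be
unbounded: by cocoercivity `η ∑ ‖∇p_k(wo)‖² ≤ λᵖ ⟪-∑ ∇J_k(wo), wo - w⟫` for every feasible `w`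
(`NetworkRegularity.exists_referenceBound_of_feasible`). The bias is then of order `μ + (η μ)²` in the
square, when `η μ` is small; otherwise boundedness of the fixed point is enough.

Finally, for `η → ∞` the minimizers `wo` converge to the solution of the constrained problem, by
compactness (`NetworkRegularity.tendsto_minimizer`).
-/

/-! ### Symmetric Hessians and gradient steps -/

/-- The norm of a symmetric operator is controlled by its quadratic form. -/
theorem norm_apply_le_of_abs_inner_le {E : Type*} [NormedAddCommGroup E] [InnerProductSpace ℝ E]
    (T : E →L[ℝ] E) (hT : ∀ u v, inner ℝ (T u) v = inner ℝ u (T v)) {c : ℝ}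
    (hc : ∀ u, |inner ℝ u (T u)| ≤ c * ‖u‖ ^ 2) (u : E) : ‖T u‖ ≤ c * ‖u‖ := by
  rcases eq_or_ne u 0 with rfl | hu
  · simp
  rcases eq_or_ne (T u) 0 with h0 | h0
  · have h1 := (abs_nonneg _).trans (hc u)
    have h2 : 0 < ‖u‖ ^ 2 := by positivity
    have h3 : 0 ≤ c := nonneg_of_mul_nonneg_left h1 h2
    rw [h0, norm_zero]
    positivity
  have hpol : ∀ x y : E, 4 * inner ℝ (T x) y ≤ 2 * c * (‖x‖ ^ 2 + ‖y‖ ^ 2) := by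
    intro x y
    have h1 := (abs_le.1 (hc (x + y))).2
    have h2 := (abs_le.1 (hc (x - y))).1
    have h3 := parallelogram_law_with_norm ℝ x y
    have h4 : inner ℝ (x + y) (T (x + y)) - inner ℝ (x - y) (T (x - y))
        = 4 * inner ℝ (T x) y := by
      have h5 := hT x y
      have h6 : inner ℝ y (T x) = inner ℝ (T x) y := real_inner_comm _ _
      simp only [map_add, map_sub, inner_add_left, inner_add_right, inner_sub_left, inner_sub_right]
      rw [h6, ← h5]; ring
    have h7 := congrArg (c * ·) h3
    rw [mul_add] at h7
    linarith
  have hup : 0 < ‖u‖ := norm_pos_iff.2 hu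
  have hTp : 0 < ‖T u‖ := norm_pos_iff.2 h0
  have h1 := hpol u ((‖u‖ / ‖T u‖) • T u)
  rw [inner_smul_right, real_inner_self_eq_norm_sq, norm_smul, norm_div, norm_norm, norm_norm,
    div_mul_cancel₀ _ hTp.ne'] at h1
  have h2 : ‖u‖ / ‖T u‖ * ‖T u‖ ^ 2 = ‖u‖ * ‖T u‖ := by field_simp
  rw [h2] at h1
  have h3 : ‖u‖ * ‖T u‖ ≤ ‖u‖ * (c * ‖u‖) := by nlinarith
  exact le_of_mul_le_mul_left h3 hup

section Calculus

variable {M : ℕ} {f : EuclideanSpace ℝ (Fin M) → ℝ} {a b : ℝ}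

theorem TwiceDifferentiable.hasGradientAt (hf : TwiceDifferentiable f)
    (x : EuclideanSpace ℝ (Fin M)) : HasGradientAt f (grad f x) x :=
  (hf.1 x).hasGradientAt

theorem TwiceDifferentiable.hasFDerivAt_grad (hf : TwiceDifferentiable f)
    (x : EuclideanSpace ℝ (Fin M)) : HasFDerivAt (grad f) (hessian f x) x :=
  (hf.2 x).hasFDerivAt

theorem TwiceDifferentiable.continuous (hf : TwiceDifferentiable f) : Continuous f :=
  hf.1.continuous

theorem TwiceDifferentiable.continuous_grad (hf : TwiceDifferentiable f) : Continuous (grad f) :=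
  hf.2.continuous

/-- The Hessian is symmetric as soon as it exists everywhere, without continuity of the second
derivative. -/
theorem TwiceDifferentiable.hessian_symm (hf : TwiceDifferentiable f)
    (x u v : EuclideanSpace ℝ (Fin M)) :
    inner ℝ (hessian f x u) v = inner ℝ u (hessian f x v) := by
  let D := (InnerProductSpace.toDual ℝ (EuclideanSpace ℝ (Fin M))).toContinuousLinearEquiv.toContinuousLinearMap
  have h1 : ∀ y, HasFDerivAt f (D (grad f y)) y := fun y => (hf.hasGradientAt y).hasFDerivAt
  have h2 : HasFDerivAt (fun y => D (grad f y)) (D.comp (hessian f x)) x :=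
    D.hasFDerivAt.comp x (hf.hasFDerivAt_grad x)
  have h3 := second_derivative_symmetric h1 h2 u v
  have h4 : inner ℝ (hessian f x u) v = inner ℝ (hessian f x v) u := h3
  rw [h4, real_inner_comm]

/-- If the Hessian of `f` lies between `a I` and `b I`, then `x ↦ s x + t ∇f(x)` is Lipschitz with
constant `max |s + t a| |s + t b|`: that number bounds the spectrum of its symmetric derivative. -/
theorem TwiceDifferentiable.norm_smul_add_smul_grad_sub_le (hf : TwiceDifferentiable f)
    (ha : HessianGE f a) (hb : HessianLE f b) {s t c : ℝ} (hca : |s + t * a| ≤ c)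
    (hcb : |s + t * b| ≤ c) (x y : EuclideanSpace ℝ (Fin M)) :
    ‖(s • x + t • grad f x) - (s • y + t • grad f y)‖ ≤ c * ‖x - y‖ := by
  have hc : 0 ≤ c := (abs_nonneg _).trans hca
  have hder : ∀ z, HasFDerivAt (fun z => s • z + t • grad f z)
      (s • ContinuousLinearMap.id ℝ _ + t • hessian f z) z := fun z =>
    ((hasFDerivAt_id z).const_smul s).add ((hf.hasFDerivAt_grad z).const_smul t)
  refine Convex.norm_image_sub_le_of_norm_hasFDerivWithin_le (𝕜 := ℝ) (s := Set.univ)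
    (f := fun z => s • z + t • grad f z)
    (fun z _ => (hder z).hasFDerivWithinAt) (fun z _ => ?_) convex_univ (Set.mem_univ y)
    (Set.mem_univ x)
  refine ContinuousLinearMap.opNorm_le_bound _ hc fun u => ?_
  refine norm_apply_le_of_abs_inner_le _ (fun u v => ?_) (fun u => ?_) u
  · simp only [add_apply, smul_apply,
      ContinuousLinearMap.id_apply, inner_add_left, inner_add_right, real_inner_smul_left,
      real_inner_smul_right, hf.hessian_symm z u v]
  · have h1 := ha z u
    have h2 := hb z u
    have h3 : inner ℝ u ((s • ContinuousLinearMap.id ℝ (EuclideanSpace ℝ (Fin M))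
        + t • hessian f z) u) = s * ‖u‖ ^ 2 + t * inner ℝ u (hessian f z u) := by
      simp only [add_apply, smul_apply,
        ContinuousLinearMap.id_apply, inner_add_right, real_inner_smul_right,
        real_inner_self_eq_norm_sq]
    rw [h3, abs_le]
    have h4 : 0 ≤ ‖u‖ ^ 2 := by positivity
    obtain ⟨h5, h6⟩ := abs_le.1 hca
    obtain ⟨h7, h8⟩ := abs_le.1 hcb
    have e1 := mul_le_mul_of_nonneg_right h5 h4
    have e2 := mul_le_mul_of_nonneg_right h6 h4
    have e3 := mul_le_mul_of_nonneg_right h7 h4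
    have e4 := mul_le_mul_of_nonneg_right h8 h4
    rcases le_total 0 t with ht | ht
    · have g1 := mul_le_mul_of_nonneg_left h1 ht
      have g2 := mul_le_mul_of_nonneg_left h2 ht
      constructor <;> linarith
    · have g1 := mul_le_mul_of_nonpos_left h1 ht
      have g2 := mul_le_mul_of_nonpos_left h2 ht
      constructor <;> linarith

theorem TwiceDifferentiable.norm_grad_sub_le (hf : TwiceDifferentiable f)
    (ha : HessianGE f a) (hb : HessianLE f b) {c : ℝ} (hca : |a| ≤ c) (hcb : |b| ≤ c)
    (x y : EuclideanSpace ℝ (Fin M)) : ‖grad f x - grad f y‖ ≤ c * ‖x - y‖ := by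
  simpa using hf.norm_smul_add_smul_grad_sub_le ha hb (s := 0) (t := 1) (c := c)
    (by simpa using hca) (by simpa using hcb) x y

/-- The gradient step `x ↦ x - t ∇f(x)` is Lipschitz with constant `max |1 - t a| |1 - t b|`. -/
theorem TwiceDifferentiable.norm_gradStep_sub_le (hf : TwiceDifferentiable f)
    (ha : HessianGE f a) (hb : HessianLE f b) {t c : ℝ} (hca : |1 - t * a| ≤ c)
    (hcb : |1 - t * b| ≤ c) (x y : EuclideanSpace ℝ (Fin M)) :
    ‖(x - t • grad f x) - (y - t • grad f y)‖ ≤ c * ‖x - y‖ := by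
  have := hf.norm_smul_add_smul_grad_sub_le ha hb (s := 1) (t := -t) (c := c)
    (by simpa [← sub_eq_add_neg] using hca) (by simpa [← sub_eq_add_neg] using hcb) x y
  simpa [← sub_eq_add_neg] using this

/-- Cocoercivity of the gradient of a convex function with Hessian at most `b I`; it restates that
the gradient step of length `2 / b` is nonexpansive. -/
theorem TwiceDifferentiable.norm_grad_sub_sq_le (hf : TwiceDifferentiable f)
    (ha : HessianGE f 0) (hb : HessianLE f b) (hb0 : 0 < b) (x y : EuclideanSpace ℝ (Fin M)) :
    ‖grad f x - grad f y‖ ^ 2 ≤ b * inner ℝ (grad f x - grad f y) (x - y) := by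
  have h := hf.norm_gradStep_sub_le ha hb (t := 2 / b) (c := 1) (by simp)
    (by rw [div_mul_cancel₀ _ hb0.ne']; norm_num) x y
  have h1 : (x - (2 / b) • grad f x) - (y - (2 / b) • grad f y)
      = (x - y) - (2 / b) • (grad f x - grad f y) := by rw [smul_sub]; abel
  rw [h1, one_mul] at h
  have h2 := pow_le_pow_left₀ (norm_nonneg _) h 2
  rw [norm_sub_sq_real, inner_smul_right, norm_smul, mul_pow, real_inner_comm] at h2
  have h3 : ‖(2 / b : ℝ)‖ ^ 2 = 4 / b ^ 2 := by
    rw [Real.norm_eq_abs, sq_abs]; ring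
  rw [h3] at h2
  have h4 : 4 / b ^ 2 * ‖grad f x - grad f y‖ ^ 2 ≤
      4 / b ^ 2 * (b * inner ℝ (grad f x - grad f y) (x - y)) := by
    have : 4 / b ^ 2 * (b * inner ℝ (grad f x - grad f y) (x - y))
        = 2 * (2 / b * inner ℝ (grad f x - grad f y) (x - y)) := by field_simp; ring
    linarith
  exact le_of_mul_le_mul_left h4 (by positivity)

theorem TwiceDifferentiable.mul_sq_le_inner_grad_sub (hf : TwiceDifferentiable f)
    (ha : HessianGE f a) (x y : EuclideanSpace ℝ (Fin M)) :
    a * ‖x - y‖ ^ 2 ≤ inner ℝ (grad f x - grad f y) (x - y) := by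
  have hd : ∀ t : ℝ, HasDerivAt (fun t : ℝ => inner ℝ (grad f (y + t • (x - y))) (x - y))
      (inner ℝ (hessian f (y + t • (x - y)) (x - y)) (x - y)) t := by
    intro t
    have h1 : HasDerivAt (fun t : ℝ => y + t • (x - y)) (x - y) t := by
      simpa using ((hasDerivAt_id t).smul_const (x - y)).const_add y
    have h2 := (hf.hasFDerivAt_grad (y + t • (x - y))).comp_hasDerivAt t h1
    simpa using h2.inner ℝ (hasDerivAt_const t (x - y))
  have h := mul_sub_le_image_sub_of_le_deriv (f := fun t : ℝ =>
    inner ℝ (grad f (y + t • (x - y))) (x - y)) (fun t => (hd t).differentiableAt)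
    (C := a * ‖x - y‖ ^ 2) (fun t => by
      rw [(hd t).deriv, real_inner_comm]; exact ha _ _) zero_le_one
  simpa [inner_sub_left] using h

theorem TwiceDifferentiable.add_inner_add_sq_le (hf : TwiceDifferentiable f)
    (ha : HessianGE f a) (x y : EuclideanSpace ℝ (Fin M)) :
    f x + inner ℝ (grad f x) (y - x) + a / 2 * ‖y - x‖ ^ 2 ≤ f y := by
  have hd : ∀ t : ℝ, HasDerivAt (fun t : ℝ => f (x + t • (y - x))
      - t * inner ℝ (grad f x) (y - x) - t ^ 2 * (a / 2 * ‖y - x‖ ^ 2))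
      (inner ℝ (grad f (x + t • (y - x))) (y - x) - inner ℝ (grad f x) (y - x)
        - t * (a * ‖y - x‖ ^ 2)) t := by
    intro t
    have h1 : HasDerivAt (fun t : ℝ => x + t • (y - x)) (y - x) t := by
      simpa using ((hasDerivAt_id t).smul_const (y - x)).const_add x
    have h2 : HasDerivAt (fun t : ℝ => f (x + t • (y - x)))
        (inner ℝ (grad f (x + t • (y - x))) (y - x)) t := by
      simpa [Function.comp_def] using
        (hf.hasGradientAt (x + t • (y - x))).hasFDerivAt.comp_hasDerivAt t h1
    have h3 := (hasDerivAt_id t).mul_const (inner ℝ (grad f x) (y - x))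
    have h4 := (hasDerivAt_pow 2 t).mul_const (a / 2 * ‖y - x‖ ^ 2)
    refine ((h2.sub h3).sub h4).congr_deriv ?_
    push_cast
    ring
  have hmono : MonotoneOn (fun t : ℝ => f (x + t • (y - x))
      - t * inner ℝ (grad f x) (y - x) - t ^ 2 * (a / 2 * ‖y - x‖ ^ 2)) (Set.Ici 0) := by
    refine monotoneOn_of_deriv_nonneg (convex_Ici 0)
      (fun t _ => (hd t).continuousAt.continuousWithinAt)
      (fun t _ => (hd t).differentiableAt.differentiableWithinAt) (fun t ht => ?_)
    rw [interior_Ici, Set.mem_Ioi] at ht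
    rw [(hd t).deriv]
    have h := hf.mul_sq_le_inner_grad_sub ha (x + t • (y - x)) x
    rw [add_sub_cancel_left, inner_smul_right, norm_smul, mul_pow, inner_sub_left,
      Real.norm_eq_abs, sq_abs] at h
    have h5 : t * (t * (a * ‖y - x‖ ^ 2)) ≤ t * (inner ℝ (grad f (x + t • (y - x))) (y - x)
        - inner ℝ (grad f x) (y - x)) := by linarith
    linarith [le_of_mul_le_mul_left h5 ht]
  have h := hmono (Set.mem_Ici.2 le_rfl) (Set.mem_Ici.2 zero_le_one) zero_le_one
  simp only [zero_smul, add_zero, zero_mul, sub_zero, one_smul, one_mul, add_sub_cancel, one_pow,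
    ne_eq, OfNat.ofNat_ne_zero, not_false_eq_true, zero_pow] at h
  linarith

theorem TwiceDifferentiable.hessianGE_zero (hf : TwiceDifferentiable f)
    (hconv : ConvexOn ℝ Set.univ f) : HessianGE f 0 := by
  intro x u
  rw [zero_mul]
  have h1 : ∀ t : ℝ, HasDerivAt (fun t : ℝ => x + t • u) u t := fun t => by
    simpa using ((hasDerivAt_id t).smul_const u).const_add x
  have h2 : ∀ t : ℝ, HasDerivAt (fun t : ℝ => f (x + t • u)) (inner ℝ (grad f (x + t • u)) u) t :=
    fun t => by
      simpa [Function.comp_def] using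
        (hf.hasGradientAt (x + t • u)).hasFDerivAt.comp_hasDerivAt t (h1 t)
  have h3 : ConvexOn ℝ Set.univ (fun t : ℝ => f (x + t • u)) := by
    have := hconv.comp_affineMap (AffineMap.lineMap x (x + u) : ℝ →ᵃ[ℝ] EuclideanSpace ℝ (Fin M))
    refine (this.congr fun t _ => ?_)
    simp [AffineMap.lineMap_apply, add_comm]
  have h4 : Monotone (fun t : ℝ => inner ℝ (grad f (x + t • u)) u) := by
    have := h3.monotoneOn_deriv (fun t _ => (h2 t).differentiableAt)
    have h5 : deriv (fun t : ℝ => f (x + t • u)) = fun t : ℝ => inner ℝ (grad f (x + t • u)) u :=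
      funext fun t => (h2 t).deriv
    rw [h5] at this
    exact monotoneOn_univ.1 this
  have h6 : HasDerivAt (fun t : ℝ => inner ℝ (grad f (x + t • u)) u)
      (inner ℝ (hessian f (x + (0:ℝ) • u) u) u) 0 := by
    have h7 := (hf.hasFDerivAt_grad (x + (0:ℝ) • u)).comp_hasDerivAt 0 (h1 0)
    simpa using h7.inner ℝ (hasDerivAt_const 0 u)
  have h8 := h4.deriv_nonneg (x := 0)
  rw [h6.deriv, zero_smul, add_zero, real_inner_comm] at h8
  exact h8

end Calculus

/-! ### Penalties -/

theorem IsInequalityPenalty.nonneg {δ : ℝ → ℝ} (h : IsInequalityPenalty δ) (x : ℝ) : 0 ≤ δ x := by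
  rcases le_or_gt x 0 with hx | hx
  · exact (h.zero_of_nonpos x hx).ge
  · exact (h.pos_of_pos x hx).le

theorem IsEqualityPenalty.nonneg {δ : ℝ → ℝ} (h : IsEqualityPenalty δ) (x : ℝ) : 0 ≤ δ x := by
  rcases eq_or_ne x 0 with rfl | hx
  · exact h.zero_at_zero.ge
  · exact (h.pos_of_ne x hx).le

theorem IsInequalityPenalty.monotone {δ : ℝ → ℝ} (h : IsInequalityPenalty δ) : Monotone δ := by
  intro x y hxy
  rcases le_or_gt x 0 with hx | hx
  · rw [h.zero_of_nonpos x hx]; exact h.nonneg y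
  rcases hxy.eq_or_lt with rfl | hlt
  · rfl
  -- convexity on `0 < x < y`, with `δ 0 = 0`
  have hy : 0 < y := hx.trans hlt
  have h1 := h.convex.2 (Set.mem_univ 0) (Set.mem_univ y) (sub_nonneg.2 ((div_le_one hy).2 hlt.le))
    (div_nonneg hx.le hy.le) (sub_add_cancel _ _)
  rw [smul_zero, zero_add, smul_eq_mul, div_mul_cancel₀ _ hy.ne', h.zero_of_nonpos 0 le_rfl,
    smul_zero, zero_add, smul_eq_mul] at h1
  refine h1.trans (mul_le_of_le_one_left (h.nonneg y) ?_)
  rw [div_le_one hy]; exact hlt.le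

section Penalty

variable {M L U : ℕ} {δIP δEP : ℝ → ℝ} {g : Fin L → EuclideanSpace ℝ (Fin M) → ℝ}
  {h : Fin U → EuclideanSpace ℝ (Fin M) →ᵃ[ℝ] ℝ}

theorem penalty_nonneg (hIP : IsInequalityPenalty δIP) (hEP : IsEqualityPenalty δEP)
    (w : EuclideanSpace ℝ (Fin M)) : 0 ≤ penalty δIP δEP g h w :=
  add_nonneg (Finset.sum_nonneg fun _ _ => hIP.nonneg _) (Finset.sum_nonneg fun _ _ => hEP.nonneg _)

theorem penalty_eq_zero_iff (hIP : IsInequalityPenalty δIP) (hEP : IsEqualityPenalty δEP)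
    (w : EuclideanSpace ℝ (Fin M)) : penalty δIP δEP g h w = 0 ↔ w ∈ constraintSet g h := by
  have hi : ∀ x, δIP x = 0 ↔ x ≤ 0 := fun x =>
    ⟨fun hx => not_lt.1 fun h' => (hIP.pos_of_pos x h').ne' hx, hIP.zero_of_nonpos x⟩
  have he : ∀ x, δEP x = 0 ↔ x = 0 := fun x =>
    ⟨fun hx => by_contra fun h' => (hEP.pos_of_ne x h').ne' hx, fun hx => hx ▸ hEP.zero_at_zero⟩
  rw [penalty, add_eq_zero_iff_of_nonneg (Finset.sum_nonneg fun _ _ => hIP.nonneg _)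
    (Finset.sum_nonneg fun _ _ => hEP.nonneg _),
    Finset.sum_eq_zero_iff_of_nonneg fun _ _ => hIP.nonneg _,
    Finset.sum_eq_zero_iff_of_nonneg fun _ _ => hEP.nonneg _]
  simp only [Finset.mem_univ, true_implies, hi, he, constraintSet, Set.mem_ofPred_eq]
  exact and_comm

theorem convexOn_univ_sum {E ι : Type*} [AddCommGroup E] [Module ℝ E] [Fintype ι] {F : ι → E → ℝ}
    (hF : ∀ i, ConvexOn ℝ Set.univ (F i)) : ConvexOn ℝ Set.univ (fun x => ∑ i, F i x) := by
  refine ⟨convex_univ, fun x _ y _ a b ha hb hab => ?_⟩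
  rw [Finset.smul_sum, Finset.smul_sum, ← Finset.sum_add_distrib]
  exact Finset.sum_le_sum fun i _ => (hF i).2 (Set.mem_univ x) (Set.mem_univ y) ha hb hab

theorem convexOn_penalty (hIP : IsInequalityPenalty δIP) (hEP : IsEqualityPenalty δEP)
    (hg : ∀ l, ConvexOn ℝ Set.univ (g l)) : ConvexOn ℝ Set.univ (penalty δIP δEP g h) := by
  refine (convexOn_univ_sum (F := fun l w => δIP (g l w)) fun l => ?_).add
    (convexOn_univ_sum (F := fun j w => δEP (h j w)) fun j => ?_)
  · refine ⟨convex_univ, fun x _ y _ a b ha hb hab => ?_⟩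
    exact (hIP.monotone ((hg l).2 (Set.mem_univ x) (Set.mem_univ y) ha hb hab)).trans
      (hIP.convex.2 (Set.mem_univ _) (Set.mem_univ _) ha hb hab)
  · exact hEP.convex.comp_affineMap (h j)

end Penalty

/-! ### Minimizers of strongly convex functions -/

/-- A differentiable strongly convex function (given by its quadratic lower bounds, with gradient
`G`) has exactly one minimizer on a nonempty closed convex set. -/
theorem existsUnique_isMinOn_of_quadratic_lower_bound {E : Type*} [NormedAddCommGroup E]
    [InnerProductSpace ℝ E] [FiniteDimensional ℝ E] {F : E → ℝ} {G : E → E} {c : ℝ} (hc : 0 < c)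
    (hF : Continuous F) (hFG : ∀ x y, F x + inner ℝ (G x) (y - x) + c * ‖y - x‖ ^ 2 ≤ F y)
    {s : Set E} (hs : IsClosed s) (hconv : Convex ℝ s) (hne : s.Nonempty) :
    ∃ z, ∀ y, (y ∈ s ∧ IsMinOn F s y) ↔ y = z := by
  obtain ⟨x₀, hx₀⟩ := hne
  have hex : ∃ z ∈ s, IsMinOn F s z := by
    refine hF.continuousOn.exists_isMinOn' hs hx₀ (Filter.Eventually.filter_mono inf_le_left ?_)
    rw [Filter.HasBasis.eventually_iff Filter.hasBasis_cocompact]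
    refine ⟨Metric.closedBall x₀ (‖G x₀‖ / c), isCompact_closedBall _ _, fun x hx => ?_⟩
    have hx' : ‖G x₀‖ / c < ‖x - x₀‖ := by
      simpa [Metric.mem_closedBall, dist_eq_norm] using hx
    have h1 := hFG x₀ x
    have h2 := neg_le_of_abs_le (abs_real_inner_le_norm (G x₀) (x - x₀))
    rw [div_lt_iff₀ hc] at hx'
    have h3 : 0 ≤ ‖x - x₀‖ * (‖x - x₀‖ * c - ‖G x₀‖) :=
      mul_nonneg (norm_nonneg _) (by linarith)
    nlinarith
  obtain ⟨z, hz, hmin⟩ := hex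
  refine ⟨z, fun y => ⟨fun ⟨hy, hymin⟩ => ?_, fun h => h ▸ ⟨hz, hmin⟩⟩⟩
  -- compare the two minimizers with their midpoint
  set m : E := (1 / 2 : ℝ) • y + (1 / 2 : ℝ) • z with hm
  have hms : m ∈ s := hconv hy hz (by norm_num) (by norm_num) (by norm_num)
  have e1 : y - m = (1 / 2 : ℝ) • (y - z) := by rw [hm]; module
  have e2 : z - m = -((1 / 2 : ℝ) • (y - z)) := by rw [hm]; module
  have h1 := hFG m y
  have h2 := hFG m z
  rw [e1] at h1
  rw [e2, inner_neg_right, norm_neg] at h2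
  have h3 : F y ≤ F m := hymin hms
  have h4 : F z ≤ F m := hmin hms
  have h5 : c * ‖(1 / 2 : ℝ) • (y - z)‖ ^ 2 ≤ 0 := by linarith
  have h6 : ‖(1 / 2 : ℝ) • (y - z)‖ ^ 2 ≤ 0 := by
    by_contra hcon
    exact absurd h5 (not_le.2 (mul_pos hc (not_le.1 hcon)))
  have h7 : ‖(1 / 2 : ℝ) • (y - z)‖ = 0 := by
    have := norm_nonneg ((1 / 2 : ℝ) • (y - z)); nlinarith
  rw [norm_eq_zero, smul_eq_zero] at h7
  rcases h7 with h7 | h7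
  · norm_num at h7
  · exact sub_eq_zero.1 h7

/-! ### Doubly stochastic combinations -/

section Combine

variable {K : Type*} [Fintype K] {M : ℕ}

theorem combine_one [DecidableEq K] (x : K → EuclideanSpace ℝ (Fin M)) :
    combine (1 : Matrix K K ℝ) x = x := by
  funext k
  simp [combine, Matrix.one_apply]

theorem combine_mul (B C : Matrix K K ℝ) (x : K → EuclideanSpace ℝ (Fin M)) :
    combine (C * B) x = combine B (combine C x) := by
  funext k
  simp only [combine, Matrix.mul_apply, Finset.sum_smul, Finset.smul_sum, smul_smul]
  rw [Finset.sum_comm]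
  refine Finset.sum_congr rfl fun l _ => Finset.sum_congr rfl fun m _ => ?_
  rw [mul_comm]

theorem combine_sub (B : Matrix K K ℝ) (x y : K → EuclideanSpace ℝ (Fin M)) (k : K) :
    combine B x k - combine B y k = combine B (fun l => x l - y l) k := by
  simp [combine, smul_sub]

/-- A vector that a positive matrix with unit column sums averages to itself is constant, by the
maximum principle. -/
theorem eq_of_sum_mul_eq_self [Nonempty K] {B : Matrix K K ℝ} (hpos : ∀ i j, 0 < B i j) (hsum : ∀ j, ∑ i, B i j = 1)
    {f : K → ℝ} (hf : ∀ k, ∑ l, B l k * f l = f k) (i j : K) : f i = f j := by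
  obtain ⟨m, hm⟩ := Finite.exists_max f
  have h1 : ∑ l, B l m * (f m - f l) = 0 := by
    simp only [mul_sub, Finset.sum_sub_distrib, hf m, ← Finset.sum_mul, hsum m, one_mul, sub_self]
  rw [Finset.sum_eq_zero_iff_of_nonneg fun l _ =>
    mul_nonneg (hpos l m).le (sub_nonneg.2 (hm l))] at h1
  have h2 : ∀ l, f l = f m := fun l => by
    rcases mul_eq_zero.1 (h1 l (Finset.mem_univ l)) with h | h
    · exact absurd h (hpos l m).ne'
    · exact (sub_eq_zero.1 h).symm
  rw [h2 i, h2 j]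

variable [DecidableEq K] {B : Matrix K K ℝ}

theorem combine_const (hB : B ∈ doublyStochastic ℝ K) (z : EuclideanSpace ℝ (Fin M)) (k : K) :
    combine B (fun _ => z) k = z := by
  rw [combine, ← Finset.sum_smul, (mem_doublyStochastic_iff_sum.1 hB).2.2 k, one_smul]

theorem sum_combine (hB : B ∈ doublyStochastic ℝ K) (x : K → EuclideanSpace ℝ (Fin M)) :
    ∑ k, combine B x k = ∑ k, x k := by
  simp only [combine]
  rw [Finset.sum_comm]
  refine Finset.sum_congr rfl fun l _ => ?_
  rw [← Finset.sum_smul, (mem_doublyStochastic_iff_sum.1 hB).2.1 l, one_smul]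

theorem norm_combine_le (hB : B ∈ doublyStochastic ℝ K) {x : K → EuclideanSpace ℝ (Fin M)} {c : ℝ}
    (hx : ∀ k, ‖x k‖ ≤ c) (k : K) : ‖combine B x k‖ ≤ c := by
  obtain ⟨h0, -, h1⟩ := mem_doublyStochastic_iff_sum.1 hB
  calc ‖combine B x k‖ ≤ ∑ l, ‖B l k • x l‖ := norm_sum_le _ _
    _ ≤ ∑ l, B l k * c := by
        refine Finset.sum_le_sum fun l _ => ?_
        rw [norm_smul, Real.norm_of_nonneg (h0 l k)]
        exact mul_le_mul_of_nonneg_left (hx l) (h0 l k)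
    _ = c := by rw [← Finset.sum_mul, h1 k, one_mul]

theorem sum_norm_combine_sq_le (hB : B ∈ doublyStochastic ℝ K)
    (x : K → EuclideanSpace ℝ (Fin M)) : ∑ k, ‖combine B x k‖ ^ 2 ≤ ∑ k, ‖x k‖ ^ 2 := by
  obtain ⟨h0, h2, h1⟩ := mem_doublyStochastic_iff_sum.1 hB
  have hconv : ConvexOn ℝ Set.univ (fun y : EuclideanSpace ℝ (Fin M) => ‖y‖ ^ 2) :=
    (convexOn_norm convex_univ).pow (fun _ _ => norm_nonneg _) 2
  calc ∑ k, ‖combine B x k‖ ^ 2 ≤ ∑ k, ∑ l, B l k * ‖x l‖ ^ 2 :=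
        Finset.sum_le_sum fun k _ => hconv.map_sum_le (t := Finset.univ) (w := fun l => B l k)
          (fun l _ => h0 l k) (h1 k) (fun l _ => Set.mem_univ (x l))
    _ = ∑ l, ‖x l‖ ^ 2 := by
        rw [Finset.sum_comm]
        refine Finset.sum_congr rfl fun l _ => ?_
        rw [← Finset.sum_mul, h2 l, one_mul]

theorem eq_of_combine_eq_self [Nonempty K] (hB : B ∈ doublyStochastic ℝ K) (hprim : B.IsPrimitive)
    {x : K → EuclideanSpace ℝ (Fin M)} (hx : combine B x = x) (i j : K) : x i = x j := by
  obtain ⟨n, -, hn⟩ := hprim.exists_pos_pow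
  have hpow : ∀ n : ℕ, combine (B ^ n) x = x := fun n => by
    induction n with
    | zero => rw [pow_zero, combine_one]
    | succ n ih => rw [pow_succ, combine_mul, ih, hx]
  have hds := pow_mem hB n
  ext c
  refine eq_of_sum_mul_eq_self (f := fun k => x k c) hn (mem_doublyStochastic_iff_sum.1 hds).2.2
    (fun k => ?_) i j
  have h := congrArg (fun y : EuclideanSpace ℝ (Fin M) => y c) (congrFun (hpow n) k)
  simpa [combine] using h

/-- The average of the iterates of the agents. -/
noncomputable def networkMean (x : K → EuclideanSpace ℝ (Fin M)) : EuclideanSpace ℝ (Fin M) :=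
  (Fintype.card K : ℝ)⁻¹ • ∑ k, x k

/-- For a primitive doubly stochastic matrix the distance of a network vector to consensus is
controlled by its change under one combination step: `x ↦ (x - combine A x, mean x)` is an
injective linear map on a finite-dimensional space. -/
theorem exists_norm_sub_networkMean_le [Nonempty K] (hB : B ∈ doublyStochastic ℝ K)
    (hprim : B.IsPrimitive) :
    ∃ κ : ℝ, 0 < κ ∧ ∀ (x : K → EuclideanSpace ℝ (Fin M)) (r : ℝ),
      (∀ k, ‖x k - combine B x k‖ ≤ r) → ∀ k, ‖x k - networkMean x‖ ≤ κ * r := by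
  have hN : (Fintype.card K : ℝ) ≠ 0 := Nat.cast_ne_zero.2 Fintype.card_ne_zero
  let F : (K → EuclideanSpace ℝ (Fin M)) →ₗ[ℝ]
      (K → EuclideanSpace ℝ (Fin M)) × EuclideanSpace ℝ (Fin M) :=
    { toFun := fun x => (fun k => x k - combine B x k, ∑ k, x k)
      map_add' := fun x y => by
        ext1
        · funext k
          simp only [combine, Pi.add_apply, smul_add, Finset.sum_add_distrib, Prod.fst_add]
          abel
        · simp [Finset.sum_add_distrib]
      map_smul' := fun c x => by
        ext1
        · funext k
          simp only [combine, Pi.smul_apply, smul_sub, Finset.smul_sum, RingHom.id_apply,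
            Prod.smul_fst, smul_comm c]
        · simp [Finset.smul_sum] }
  have hker : F.ker = ⊥ := by
    rw [LinearMap.ker_eq_bot']
    intro x hx
    have h1 : combine B x = x := by
      funext k
      exact (sub_eq_zero.1 (congrFun (congrArg Prod.fst hx) k)).symm
    have h2 : ∑ k, x k = 0 := congrArg Prod.snd hx
    funext k
    have h3 : ∑ l, x l = (Fintype.card K : ℝ) • x k := by
      rw [Finset.sum_congr rfl fun l _ => eq_of_combine_eq_self hB hprim h1 l k, Finset.sum_const,
        Finset.card_univ, Nat.cast_smul_eq_nsmul]
    rw [h2] at h3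
    exact (smul_eq_zero.1 h3.symm).resolve_left hN
  obtain ⟨κ, hκ, hanti⟩ := F.exists_antilipschitzWith hker
  refine ⟨κ, hκ, fun x r hr k => ?_⟩
  have hr0 : 0 ≤ r := (norm_nonneg _).trans (hr k)
  set y : K → EuclideanSpace ℝ (Fin M) := fun k => x k - networkMean x with hy
  have h1 := hanti.le_mul_dist y 0
  rw [map_zero, dist_zero_right, dist_zero_right] at h1
  have h2 : ‖F y‖ ≤ r := by
    refine (Prod.norm_def (F y)).trans_le (max_le ((pi_norm_le_iff_of_nonneg hr0).2 fun l => ?_) ?_)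
    · have h3 : combine B y l = combine B x l - networkMean x := by
        rw [← combine_const hB (networkMean x) l, combine_sub]
      change ‖y l - combine B y l‖ ≤ r
      rw [h3, hy, sub_sub_sub_cancel_right]
      exact hr l
    · change ‖∑ k, y k‖ ≤ r
      have h3 : ∑ k, y k = 0 := by
        simp only [hy, Finset.sum_sub_distrib, Finset.sum_const, Finset.card_univ, networkMean]
        rw [← Nat.cast_smul_eq_nsmul ℝ, smul_smul, mul_inv_cancel₀ hN, one_smul, sub_self]
      rw [h3, norm_zero]
      exact hr0
  calc ‖x k - networkMean x‖ ≤ ‖y‖ := norm_le_pi_norm y k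
    _ ≤ κ * ‖F y‖ := h1
    _ ≤ κ * r := mul_le_mul_of_nonneg_left h2 κ.2

end Combine

/-! ### The noise-free recursion -/

/-- The smoothness and convexity of the costs and the penalties on which the analysis rests. -/
structure NetworkRegularity {K : Type*} {M : ℕ} (J p : K → EuclideanSpace ℝ (Fin M) → ℝ)
    (lmin lmax lp : K → ℝ) : Prop where
  lmin_pos : ∀ k, 0 < lmin k
  lmax_pos : ∀ k, 0 < lmax k
  lp_pos : ∀ k, 0 < lp k
  cost : ∀ k, TwiceDifferentiable (J k)
  cost_ge : ∀ k, HessianGE (J k) (lmin k)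
  cost_le : ∀ k, HessianLE (J k) (lmax k)
  pen : ∀ k, TwiceDifferentiable (p k)
  pen_ge : ∀ k, HessianGE (p k) 0
  pen_le : ∀ k, HessianLE (p k) (lp k)

/-- The adaptation of agent `k` without gradient noise: a gradient step on the cost followed by a
gradient step on the penalty. -/
noncomputable def adaptStep {K : Type*} {M : ℕ} (J p : K → EuclideanSpace ℝ (Fin M) → ℝ) (μ η : ℝ) (k : K)
    (y : EuclideanSpace ℝ (Fin M)) : EuclideanSpace ℝ (Fin M) :=
  (y - μ • grad (J k) y) - (μ * η) • grad (p k) (y - μ • grad (J k) y)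

theorem diffusionStep_zero {K : Type*} [Fintype K] {M : ℕ}
    (J p : K → EuclideanSpace ℝ (Fin M) → ℝ) (A₁ A₂ : Matrix K K ℝ) (μ η : ℝ)
    (x : K → EuclideanSpace ℝ (Fin M)) :
    diffusionStep J p A₁ A₂ μ η 0 x
      = combine A₂ (fun k => adaptStep J p μ η k (combine A₁ x k)) := by
  simp [diffusionStep, adaptStep]

section NoiseFree

variable {K : Type*} {M : ℕ} {J p : K → EuclideanSpace ℝ (Fin M) → ℝ}
  {lmin lmax lp : K → ℝ} {μ η : ℝ}

theorem NetworkRegularity.norm_penaltyStep_sub_le (hreg : NetworkRegularity J p lmin lmax lp)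
    (hμ : 0 < μ) (hη : 0 < η) {k : K} (hlp : η * μ * lp k ≤ 2) (x y : EuclideanSpace ℝ (Fin M)) :
    ‖(x - (μ * η) • grad (p k) x) - (y - (μ * η) • grad (p k) y)‖ ≤ ‖x - y‖ := by
  have h0 : 0 ≤ η * μ * lp k := mul_nonneg (mul_pos hη hμ).le (hreg.lp_pos k).le
  have h := (hreg.pen k).norm_gradStep_sub_le (hreg.pen_ge k) (hreg.pen_le k) (t := μ * η)
    (c := 1) (by simp) (by rw [abs_le]; constructor <;> linarith [mul_comm μ η ▸ h0, mul_comm μ η ▸ hlp]) x y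
  simpa using h

theorem NetworkRegularity.norm_adaptStep_sub_le (hreg : NetworkRegularity J p lmin lmax lp)
    (hμ : 0 < μ) (hη : 0 < η) {k : K} {γ : ℝ} (h₁ : |1 - μ * lmin k| ≤ γ)
    (h₂ : |1 - μ * lmax k| ≤ γ) (hlp : η * μ * lp k ≤ 2) (x y : EuclideanSpace ℝ (Fin M)) :
    ‖adaptStep J p μ η k x - adaptStep J p μ η k y‖ ≤ γ * ‖x - y‖ :=
  (hreg.norm_penaltyStep_sub_le hμ hη hlp _ _).trans
    ((hreg.cost k).norm_gradStep_sub_le (hreg.cost_ge k) (hreg.cost_le k) h₁ h₂ x y)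

variable [Fintype K] [DecidableEq K] {A₁ A₂ : Matrix K K ℝ}

/-- In the supremum norm over the agents the noise-free recursion is a contraction, so that it
converges to its only fixed point. -/
theorem exists_fixedPoint_diffusionStep (hA₁ : A₁ ∈ doublyStochastic ℝ K)
    (hA₂ : A₂ ∈ doublyStochastic ℝ K) {γ : ℝ} (hγ0 : 0 ≤ γ) (hγ1 : γ < 1)
    (hadapt : ∀ k x y, ‖adaptStep J p μ η k x - adaptStep J p μ η k y‖ ≤ γ * ‖x - y‖) :
    ∃ winf : K → EuclideanSpace ℝ (Fin M), diffusionStep J p A₁ A₂ μ η 0 winf = winf ∧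
      ∀ x, Tendsto (fun i : ℕ => (diffusionStep J p A₁ A₂ μ η 0)^[i] x) atTop (𝓝 winf) := by
  have hc : ContractingWith ⟨γ, hγ0⟩ (diffusionStep J p A₁ A₂ μ η 0) := by
    refine ⟨NNReal.coe_lt_coe.1 hγ1, LipschitzWith.of_dist_le_mul fun x y => ?_⟩
    rw [dist_eq_norm, dist_eq_norm]
    have h0 : 0 ≤ γ * ‖x - y‖ := mul_nonneg hγ0 (norm_nonneg _)
    refine (pi_norm_le_iff_of_nonneg h0).2 fun k => ?_
    rw [Pi.sub_apply, diffusionStep_zero, diffusionStep_zero, combine_sub]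
    refine norm_combine_le hA₂ (fun l => (hadapt l _ _).trans ?_) k
    refine mul_le_mul_of_nonneg_left ?_ hγ0
    rw [combine_sub]
    exact norm_combine_le hA₁ (fun m => norm_le_pi_norm (x - y) m) l
  exact ⟨hc.fixedPoint, hc.fixedPoint_isFixedPt, hc.tendsto_iterate_fixedPoint⟩

end NoiseFree

/-! ### The step-size threshold -/

section Threshold

variable {K : Type*} [Fintype K] [Nonempty K] {lmin lmax lp : K → ℝ} {α : ℝ}

/-- Uniformly away from the threshold, the mean-square contraction factor
`(1 - μ λ)² + 2 α μ²` of the gradient steps is at most `1 - c μ`, with `c` independent of `η`. -/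
theorem exists_contraction_rate (hmin : ∀ k, 0 < lmin k) (hmax : ∀ k, 0 < lmax k)
    (hlp : ∀ k, 0 < lp k) (hα : 0 ≤ α) {ρ : ℝ} (hρ0 : 0 < ρ) (hρ1 : ρ < 1) :
    ∃ c μ₀ : ℝ, 0 < c ∧ 0 < μ₀ ∧ ∀ η μ, 0 < η → 0 < μ →
      μ ≤ ρ * stepThreshold lmin lmax lp α η → μ ≤ μ₀ ∧ ∀ k,
        (1 - μ * lmin k) ^ 2 + 2 * α * μ ^ 2 ≤ 1 - c * μ ∧
        (1 - μ * lmax k) ^ 2 + 2 * α * μ ^ 2 ≤ 1 - c * μ ∧ η * μ * lp k ≤ 2 := by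
  obtain ⟨a, ha⟩ := Finite.exists_min fun k => min (lmin k) (lmax k)
  set m := min (lmin a) (lmax a) with hm
  have hm0 : 0 < m := lt_min (hmin a) (hmax a)
  obtain ⟨k₀⟩ := ‹Nonempty K›
  refine ⟨2 * (1 - ρ) * m, 2 / lmin k₀, mul_pos (by linarith) hm0,
    div_pos two_pos (hmin k₀), fun η μ hη hμ hle => ?_⟩
  have hT : ∀ k, stepThreshold lmin lmax lp α η ≤ min (2 * lmax k / (lmax k ^ 2 + 2 * α))
      (min (2 * lmin k / (lmin k ^ 2 + 2 * α)) (2 / (η * lp k))) := fun k =>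
    Finset.inf'_le _ (Finset.mem_univ k)
  have key : ∀ lam : ℝ, 0 < lam → μ ≤ ρ * (2 * lam / (lam ^ 2 + 2 * α)) →
      μ * (lam ^ 2 + 2 * α) ≤ 2 * ρ * lam := by
    intro lam hlam h
    have hd : 0 < lam ^ 2 + 2 * α := by positivity
    calc μ * (lam ^ 2 + 2 * α) ≤ ρ * (2 * lam / (lam ^ 2 + 2 * α)) * (lam ^ 2 + 2 * α) :=
          mul_le_mul_of_nonneg_right h hd.le
      _ = 2 * ρ * lam := by field_simp
  have h1 : ∀ k, μ * (lmax k ^ 2 + 2 * α) ≤ 2 * ρ * lmax k := fun k =>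
    key _ (hmax k) (hle.trans (mul_le_mul_of_nonneg_left ((hT k).trans (min_le_left _ _)) hρ0.le))
  have h2 : ∀ k, μ * (lmin k ^ 2 + 2 * α) ≤ 2 * ρ * lmin k := fun k =>
    key _ (hmin k) (hle.trans (mul_le_mul_of_nonneg_left ((hT k).trans
      ((min_le_right _ _).trans (min_le_left _ _))) hρ0.le))
  have h3 : ∀ k, η * μ * lp k ≤ 2 := fun k => by
    have h4 : μ ≤ ρ * (2 / (η * lp k)) := hle.trans (mul_le_mul_of_nonneg_left ((hT k).trans
      ((min_le_right _ _).trans (min_le_right _ _))) hρ0.le)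
    have hd : 0 < η * lp k := mul_pos hη (hlp k)
    have hlp' := (hlp k).ne'
    calc η * μ * lp k = μ * (η * lp k) := by ring
      _ ≤ ρ * (2 / (η * lp k)) * (η * lp k) := mul_le_mul_of_nonneg_right h4 hd.le
      _ = 2 * ρ := by field_simp
      _ ≤ 2 := by linarith
  have hrate : ∀ lam : ℝ, m ≤ lam → μ * (lam ^ 2 + 2 * α) ≤ 2 * ρ * lam →
      (1 - μ * lam) ^ 2 + 2 * α * μ ^ 2 ≤ 1 - 2 * (1 - ρ) * m * μ := by
    intro lam hlam h
    have e1 := mul_le_mul_of_nonneg_left h hμ.le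
    have e2 : 0 ≤ 2 * (1 - ρ) * μ * (lam - m) :=
      mul_nonneg (mul_nonneg (by linarith) hμ.le) (by linarith)
    nlinarith
  refine ⟨?_, fun k => ⟨hrate _ ((ha k).trans (min_le_left _ _)) (h2 k),
    hrate _ ((ha k).trans (min_le_right _ _)) (h1 k), h3 k⟩⟩
  rw [le_div_iff₀ (hmin k₀)]
  have e1 := h2 k₀
  have e2 := hmin k₀
  have e3 : 0 ≤ μ * (2 * α) := by positivity
  have e4 : lmin k₀ * (μ * lmin k₀) ≤ lmin k₀ * 2 := by nlinarith
  exact le_of_mul_le_mul_left e4 e2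

end Threshold

/-! ### The bias of the fixed point -/

/-- The optimality condition `∑ (∇J_k(φ_k) + η ∇p_k(ζ_k)) = 0` of a fixed point, tested with
`x - wo` for any point `x` close to all `φ_k`. Strong monotonicity of `∇J_k` controls `x - wo`;
cocoercivity of `∇p_k` controls the differences of the penalty gradients with the *large* weight
`η`, which is what makes the estimate uniform in `η`. -/
theorem energy_estimate {K E : Type*} [Fintype K] [NormedAddCommGroup E] [InnerProductSpace ℝ E]
    {gJ gp : K → E → E} {L m P B Q η μ : ℝ} (hm : 0 < m) (hP : 0 < P) (hη : 0 < η)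
    (hLip : ∀ k x y, ‖gJ k x - gJ k y‖ ≤ L * ‖x - y‖)
    (hmono : ∀ k x y, m * ‖x - y‖ ^ 2 ≤ inner ℝ (gJ k x - gJ k y) (x - y))
    (hcoc : ∀ k x y, ‖gp k x - gp k y‖ ^ 2 ≤ P * inner ℝ (gp k x - gp k y) (x - y))
    {wo x : E} {φ ζ : K → E} (hζ : ∀ k, ζ k = φ k - μ • gJ k (φ k))
    (hopt : ∑ k, (gJ k wo + η • gp k wo) = 0) (hsum : ∑ k, (gJ k (φ k) + η • gp k (ζ k)) = 0)
    (hB : ∀ k, ‖gJ k (φ k)‖ ≤ B) (hQ : ∀ k, ‖φ k - x‖ ^ 2 ≤ Q) :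
    Fintype.card K * (m / 2) * ‖x - wo‖ ^ 2 + η / (2 * P) * ∑ k, ‖gp k (ζ k) - gp k wo‖ ^ 2
      ≤ Fintype.card K * (L ^ 2 / (2 * m) * Q + η * P * (Q + μ ^ 2 * B ^ 2)) := by
  have hk : ∀ k, m / 2 * ‖x - wo‖ ^ 2 + η / (2 * P) * ‖gp k (ζ k) - gp k wo‖ ^ 2
      - (L ^ 2 / (2 * m) * Q + η * P * (Q + μ ^ 2 * B ^ 2))
      ≤ inner ℝ ((gJ k (φ k) + η • gp k (ζ k)) - (gJ k wo + η • gp k wo)) (x - wo) := by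
    intro k
    set d := gp k (ζ k) - gp k wo with hd
    have e1 : inner ℝ ((gJ k (φ k) + η • gp k (ζ k)) - (gJ k wo + η • gp k wo)) (x - wo)
        = inner ℝ (gJ k x - gJ k wo) (x - wo) + inner ℝ (gJ k (φ k) - gJ k x) (x - wo)
          + η * (inner ℝ d (ζ k - wo) + inner ℝ d (x - ζ k)) := by
      rw [← inner_add_right, ← inner_add_left, ← real_inner_smul_left, hd]
      rw [show ζ k - wo + (x - ζ k) = x - wo by abel, ← inner_add_left]
      congr 1
      rw [smul_sub]; abel
    have h1 := hmono k x wo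
    have h2 : -(m / 2 * ‖x - wo‖ ^ 2 + L ^ 2 / (2 * m) * Q)
        ≤ inner ℝ (gJ k (φ k) - gJ k x) (x - wo) := by
      have g1 := neg_le_of_abs_le (abs_real_inner_le_norm (gJ k (φ k) - gJ k x) (x - wo))
      have g2 : ‖gJ k (φ k) - gJ k x‖ ^ 2 ≤ L ^ 2 * Q := by
        calc ‖gJ k (φ k) - gJ k x‖ ^ 2 ≤ (L * ‖φ k - x‖) ^ 2 :=
              pow_le_pow_left₀ (norm_nonneg _) (hLip k _ _) 2
          _ = L ^ 2 * ‖φ k - x‖ ^ 2 := by ring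
          _ ≤ L ^ 2 * Q := mul_le_mul_of_nonneg_left (hQ k) (sq_nonneg _)
      have g3 : ‖gJ k (φ k) - gJ k x‖ * ‖x - wo‖
          ≤ m / 2 * ‖x - wo‖ ^ 2 + 1 / (2 * m) * ‖gJ k (φ k) - gJ k x‖ ^ 2 := by
        have : 0 ≤ 1 / (2 * m) * (‖gJ k (φ k) - gJ k x‖ - m * ‖x - wo‖) ^ 2 := by positivity
        have e : 1 / (2 * m) * (‖gJ k (φ k) - gJ k x‖ - m * ‖x - wo‖) ^ 2
          = 1 / (2 * m) * ‖gJ k (φ k) - gJ k x‖ ^ 2 + m / 2 * ‖x - wo‖ ^ 2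
            - ‖gJ k (φ k) - gJ k x‖ * ‖x - wo‖ := by field_simp; ring
        linarith
      have g4 : 1 / (2 * m) * ‖gJ k (φ k) - gJ k x‖ ^ 2 ≤ L ^ 2 / (2 * m) * Q := by
        calc 1 / (2 * m) * ‖gJ k (φ k) - gJ k x‖ ^ 2 ≤ 1 / (2 * m) * (L ^ 2 * Q) :=
              mul_le_mul_of_nonneg_left g2 (by positivity)
          _ = L ^ 2 / (2 * m) * Q := by ring
      linarith
    have h3 : 1 / P * ‖d‖ ^ 2 ≤ inner ℝ d (ζ k - wo) := by
      have g := hcoc k (ζ k) wo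
      rw [one_div, inv_mul_le_iff₀ hP]
      exact g
    have h4 : -(1 / (2 * P) * ‖d‖ ^ 2 + P * (Q + μ ^ 2 * B ^ 2)) ≤ inner ℝ d (x - ζ k) := by
      have g1 := neg_le_of_abs_le (abs_real_inner_le_norm d (x - ζ k))
      have g2 : ‖x - ζ k‖ ^ 2 ≤ 2 * (Q + μ ^ 2 * B ^ 2) := by
        have t1 : ‖x - ζ k‖ ≤ ‖φ k - x‖ + ‖μ • gJ k (φ k)‖ := by
          rw [hζ k, show x - (φ k - μ • gJ k (φ k)) = -(φ k - x) + μ • gJ k (φ k) by abel,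
            ← norm_neg (φ k - x)]
          exact norm_add_le _ _
        have t2 : ‖μ • gJ k (φ k)‖ ^ 2 ≤ μ ^ 2 * B ^ 2 := by
          rw [norm_smul, mul_pow, Real.norm_eq_abs, sq_abs]
          exact mul_le_mul_of_nonneg_left (pow_le_pow_left₀ (norm_nonneg _) (hB k) 2)
            (sq_nonneg _)
        have t3 := pow_le_pow_left₀ (norm_nonneg _) t1 2
        have t4 := sq_nonneg (‖φ k - x‖ - ‖μ • gJ k (φ k)‖)
        have t5 := hQ k
        linarith [add_sq ‖φ k - x‖ ‖μ • gJ k (φ k)‖, sub_sq ‖φ k - x‖ ‖μ • gJ k (φ k)‖]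
      have g3 : ‖d‖ * ‖x - ζ k‖ ≤ 1 / (2 * P) * ‖d‖ ^ 2 + P / 2 * ‖x - ζ k‖ ^ 2 := by
        have : 0 ≤ 1 / (2 * P) * (‖d‖ - P * ‖x - ζ k‖) ^ 2 := by positivity
        have e : 1 / (2 * P) * (‖d‖ - P * ‖x - ζ k‖) ^ 2
          = 1 / (2 * P) * ‖d‖ ^ 2 + P / 2 * ‖x - ζ k‖ ^ 2 - ‖d‖ * ‖x - ζ k‖ := by
          field_simp; ring
        linarith
      have g4 := mul_le_mul_of_nonneg_left g2 (half_pos hP).le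
      linarith
    have h5 : 1 / (2 * P) * ‖d‖ ^ 2 - P * (Q + μ ^ 2 * B ^ 2)
        ≤ inner ℝ d (ζ k - wo) + inner ℝ d (x - ζ k) := by
      have : 1 / P * ‖d‖ ^ 2 = 1 / (2 * P) * ‖d‖ ^ 2 + 1 / (2 * P) * ‖d‖ ^ 2 := by
        field_simp; ring
      linarith
    have h6 := mul_le_mul_of_nonneg_left h5 hη.le
    have h7 : η * (1 / (2 * P) * ‖d‖ ^ 2 - P * (Q + μ ^ 2 * B ^ 2))
      = η / (2 * P) * ‖d‖ ^ 2 - η * P * (Q + μ ^ 2 * B ^ 2) := by ring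
    rw [e1]
    linarith
  have hs := Finset.sum_le_sum fun k (_ : k ∈ Finset.univ) => hk k
  have hz : ∑ k, ((gJ k (φ k) + η • gp k (ζ k)) - (gJ k wo + η • gp k wo)) = 0 := by
    rw [Finset.sum_sub_distrib, hsum, hopt, sub_zero]
  rw [← sum_inner, hz, inner_zero_left] at hs
  simp only [Finset.sum_sub_distrib, Finset.sum_add_distrib, ← Finset.mul_sum, Finset.sum_const,
    Finset.card_univ, nsmul_eq_mul] at hs
  simp only [Finset.mul_sum] at hs ⊢
  linarith

theorem norm_sub_sq_le_two_mul {E : Type*} [SeminormedAddCommGroup E] (a b c : E) :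
    ‖a - c‖ ^ 2 ≤ 2 * ‖a - b‖ ^ 2 + 2 * ‖b - c‖ ^ 2 := by
  have h1 : ‖a - c‖ ≤ ‖a - b‖ + ‖b - c‖ := norm_sub_le_norm_sub_add_norm_sub a b c
  have h2 := pow_le_pow_left₀ (norm_nonneg _) h1 2
  linarith [sq_nonneg (‖a - b‖ - ‖b - c‖), add_sq ‖a - b‖ ‖b - c‖, sub_sq ‖a - b‖ ‖b - c‖]

/-- For a small product `η μ` the energy estimate closes: the contribution of the penalty
gradients to the right-hand side is absorbed by the left-hand side. -/
theorem energy_closure {N m P L κ B₁ B μ₀ : ℝ} (hN : 0 < N) (hm : 0 < m) (hP : 0 < P)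
    (hμ₀ : 0 < μ₀) :
    ∃ C τ₁ : ℝ, 0 ≤ C ∧ 0 < τ₁ ∧ ∀ η μ X S q : ℝ, 0 < η → 0 < μ → μ ≤ μ₀ → η * μ ≤ τ₁ →
      0 ≤ X → 0 ≤ S → q = μ ^ 2 * (3 * (B₁ ^ 2 + η * B ^ 2 + η ^ 2 * S)) →
      N * (m / 2) * X + η / (2 * P) * S
        ≤ N * (L ^ 2 / (2 * m) * (κ ^ 2 * q) + η * P * (κ ^ 2 * q + μ ^ 2 * B₁ ^ 2)) →
      X + q ≤ C * (μ + (η * μ) ^ 2) := by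
  obtain ⟨a, ha⟩ : ∃ y, y = 3 * N * κ ^ 2 * (L ^ 2 / (2 * m)) := ⟨_, rfl⟩
  obtain ⟨b, hb⟩ : ∃ y, y = 3 * N * κ ^ 2 * P := ⟨_, rfl⟩
  have ha0 : 0 ≤ a := by rw [ha]; positivity
  have hb0 : 0 ≤ b := by rw [hb]; positivity
  obtain ⟨Λ, hΛ⟩ : ∃ y, y = a * μ₀ + b := ⟨_, rfl⟩
  have hΛ0 : 0 ≤ Λ := by rw [hΛ]; positivity
  obtain ⟨D, hD⟩ : ∃ y, y = a * (B₁ ^ 2 * μ₀ + B ^ 2) + b * (B₁ ^ 2 + B ^ 2) + N * P * B₁ ^ 2 := ⟨_, rfl⟩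
  have hD0 : 0 ≤ D := by rw [hD]; positivity
  refine ⟨2 * D / (N * m) + 3 * (B₁ ^ 2 * μ₀ + B ^ 2) + 12 * μ₀ * P * D,
    min 1 (1 / (4 * P * (Λ + 1))), by positivity, by positivity,
    fun η μ X S q hη hμ hμle hτ hX hS hq hE => ?_⟩
  obtain ⟨τ, hτdef⟩ : ∃ τ, τ = η * μ := ⟨_, rfl⟩
  obtain ⟨s, hsdef⟩ : ∃ s, s = η * S := ⟨_, rfl⟩
  rw [← hτdef] at hτ ⊢
  have hτ0 : 0 < τ := hτdef ▸ mul_pos hη hμ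
  have hs0 : 0 ≤ s := hsdef ▸ mul_nonneg hη.le hS
  have hτ1 : τ ≤ 1 := hτ.trans (min_le_left _ _)
  have hτ2 : Λ * τ ≤ 1 / (4 * P) := by
    have h1 := hτ.trans (min_le_right _ _)
    calc Λ * τ ≤ (Λ + 1) * (1 / (4 * P * (Λ + 1))) :=
          mul_le_mul (by linarith) h1 hτ0.le (by linarith)
      _ = 1 / (4 * P) := by field_simp
  have hq' : q = 3 * (B₁ ^ 2 * μ ^ 2 + B ^ 2 * (μ * τ) + τ * μ * s) := by
    rw [hq, hτdef, hsdef]; ring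
  have hηq : η * q = 3 * (B₁ ^ 2 * (τ * μ) + B ^ 2 * τ ^ 2 + τ ^ 2 * s) := by
    rw [hq, hτdef, hsdef]; ring
  have hμ2 : μ ^ 2 ≤ μ₀ * μ := by rw [sq]; exact mul_le_mul_of_nonneg_right hμle hμ.le
  have hμτ : μ * τ ≤ μ := mul_le_of_le_one_right hμ.le hτ1
  have hττ : τ ^ 2 ≤ τ := by rw [sq]; exact mul_le_of_le_one_right hτ0.le hτ1
  have hτμ : τ * μ ≤ τ * μ₀ := mul_le_mul_of_nonneg_left hμle hτ0.le
  have hE' : N * (m / 2) * X + 1 / (2 * P) * s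
      ≤ a * (B₁ ^ 2 * μ ^ 2 + B ^ 2 * (μ * τ)) + b * (B₁ ^ 2 * (μ * τ) + B ^ 2 * τ ^ 2)
        + N * P * B₁ ^ 2 * (μ * τ) + (a * (τ * μ) + b * τ ^ 2) * s := by
    have l1 : η / (2 * P) * S = 1 / (2 * P) * s := by rw [hsdef]; ring
    have l2 : N * (L ^ 2 / (2 * m) * (κ ^ 2 * q) + η * P * (κ ^ 2 * q + μ ^ 2 * B₁ ^ 2))
        = N * κ ^ 2 * (L ^ 2 / (2 * m)) * q + N * κ ^ 2 * P * (η * q)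
          + N * P * B₁ ^ 2 * (μ * (η * μ)) := by ring
    rw [l1, l2, hηq, ← hτdef, hq'] at hE
    calc _ ≤ _ := hE
      _ = _ := by rw [ha, hb]; ring
  have hab : (a * (τ * μ) + b * τ ^ 2) * s ≤ 1 / (4 * P) * s := by
    refine mul_le_mul_of_nonneg_right ?_ hs0
    have l1 := mul_le_mul_of_nonneg_left hτμ ha0
    have l2 := mul_le_mul_of_nonneg_left hττ hb0
    calc a * (τ * μ) + b * τ ^ 2 ≤ a * (τ * μ₀) + b * τ := add_le_add l1 l2
      _ = Λ * τ := by rw [hΛ]; ring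
      _ ≤ _ := hτ2
  have hB2 : B₁ ^ 2 * μ ^ 2 + B ^ 2 * (μ * τ) ≤ (B₁ ^ 2 * μ₀ + B ^ 2) * μ := by
    have l1 := mul_le_mul_of_nonneg_left hμ2 (sq_nonneg B₁)
    have l2 := mul_le_mul_of_nonneg_left hμτ (sq_nonneg B)
    linarith
  have hτsq : 0 ≤ τ ^ 2 := sq_nonneg τ
  have hrest : a * (B₁ ^ 2 * μ ^ 2 + B ^ 2 * (μ * τ)) + b * (B₁ ^ 2 * (μ * τ) + B ^ 2 * τ ^ 2)
        + N * P * B₁ ^ 2 * (μ * τ) ≤ D * (μ + τ ^ 2) := by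
    have l1 := mul_le_mul_of_nonneg_left hB2 ha0
    have l2 : b * (B₁ ^ 2 * (μ * τ) + B ^ 2 * τ ^ 2) ≤ b * ((B₁ ^ 2 + B ^ 2) * (μ + τ ^ 2)) := by
      refine mul_le_mul_of_nonneg_left ?_ hb0
      have := mul_le_mul_of_nonneg_left hμτ (sq_nonneg B₁)
      have := mul_nonneg (sq_nonneg B₁) hτsq
      have := mul_nonneg (sq_nonneg B) hμ.le
      linarith
    have l3 : N * P * B₁ ^ 2 * (μ * τ) ≤ N * P * B₁ ^ 2 * (μ + τ ^ 2) :=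
      mul_le_mul_of_nonneg_left (by linarith) (by positivity)
    have l4 : a * ((B₁ ^ 2 * μ₀ + B ^ 2) * μ) ≤ a * ((B₁ ^ 2 * μ₀ + B ^ 2) * (μ + τ ^ 2)) :=
      mul_le_mul_of_nonneg_left (mul_le_mul_of_nonneg_left (by linarith) (by positivity)) ha0
    calc _ ≤ a * ((B₁ ^ 2 * μ₀ + B ^ 2) * (μ + τ ^ 2)) + b * ((B₁ ^ 2 + B ^ 2) * (μ + τ ^ 2))
          + N * P * B₁ ^ 2 * (μ + τ ^ 2) := by linarith
      _ = _ := by rw [hD]; ring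
  have hhalf : 1 / (2 * P) * s = 1 / (4 * P) * s + 1 / (4 * P) * s := by field_simp; ring
  have hs4 : 0 ≤ 1 / (4 * P) * s := by positivity
  have hNX : 0 ≤ N * (m / 2) * X := by positivity
  have hXle : X ≤ 2 * D / (N * m) * (μ + τ ^ 2) := by
    have l : N * (m / 2) * X ≤ D * (μ + τ ^ 2) := by linarith
    calc X = 2 / (N * m) * (N * (m / 2) * X) := by field_simp
      _ ≤ 2 / (N * m) * (D * (μ + τ ^ 2)) := mul_le_mul_of_nonneg_left l (by positivity)
      _ = _ := by ring
  have hsle : s ≤ 4 * P * D * (μ + τ ^ 2) := by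
    have l : 1 / (4 * P) * s ≤ D * (μ + τ ^ 2) := by linarith
    calc s = 4 * P * (1 / (4 * P) * s) := by field_simp
      _ ≤ 4 * P * (D * (μ + τ ^ 2)) := mul_le_mul_of_nonneg_left l (by positivity)
      _ = _ := by ring
  have hqle : q ≤ 3 * (B₁ ^ 2 * μ₀ + B ^ 2) * (μ + τ ^ 2)
      + 12 * μ₀ * P * D * (μ + τ ^ 2) := by
    have l1 : τ * μ * s ≤ μ₀ * s :=
      mul_le_mul_of_nonneg_right ((mul_le_of_le_one_left hμ.le hτ1).trans hμle) hs0
    have l2 := mul_le_mul_of_nonneg_left hsle hμ₀.le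
    have l3 : 0 ≤ (B₁ ^ 2 * μ₀ + B ^ 2) * τ ^ 2 := by positivity
    rw [hq']
    linarith
  linarith

theorem norm_add_smul_sq_le {E : Type*} [NormedAddCommGroup E] [NormedSpace ℝ E] {a b c : E}
    {B₁ B S η : ℝ} (hη : 0 < η) (ha : ‖a‖ ≤ B₁) (hb : η * ‖b‖ ^ 2 ≤ B ^ 2)
    (hS : ‖c - b‖ ^ 2 ≤ S) :
    ‖a + η • c‖ ^ 2 ≤ 3 * (B₁ ^ 2 + η * B ^ 2 + η ^ 2 * S) := by
  have h1 : ‖a + η • c‖ ≤ B₁ + η * ‖b‖ + η * ‖c - b‖ := by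
    have h2 : ‖c‖ ≤ ‖b‖ + ‖c - b‖ := by
      simpa using norm_add_le b (c - b)
    have h3 := norm_add_le a (η • c)
    rw [norm_smul, Real.norm_of_nonneg hη.le] at h3
    have h4 := mul_le_mul_of_nonneg_left h2 hη.le
    linarith
  have h2 := pow_le_pow_left₀ (norm_nonneg _) h1 2
  have h4 := mul_le_mul_of_nonneg_left hS (sq_nonneg η)
  have h5 := mul_le_mul_of_nonneg_left hb hη.le
  have h6 : (B₁ + η * ‖b‖ + η * ‖c - b‖) ^ 2
      ≤ 3 * (B₁ ^ 2 + η * (η * ‖b‖ ^ 2) + η ^ 2 * ‖c - b‖ ^ 2) := by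
    have t1 := sq_nonneg (B₁ - η * ‖b‖)
    have t2 := sq_nonneg (B₁ - η * ‖c - b‖)
    have t3 := sq_nonneg (η * ‖b‖ - η * ‖c - b‖)
    linarith
  linarith

/-- The bias of a fixed point of the noise-free recursion: `φ` collects the points after the first
combination, `ζ` those after the cost step and `ψ` those after the penalty step. The constant depends
on `η` only through the bound `η ‖∇p_k(wo)‖² ≤ B²`. -/
theorem exists_bias_bound {K : Type*} [Fintype K] [Nonempty K] {M : ℕ}
    {gJ gp : K → EuclideanSpace ℝ (Fin M) → EuclideanSpace ℝ (Fin M)}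
    {L m P B₁ B κ R μ₀ : ℝ} (hm : 0 < m) (hP : 0 < P) (hμ₀ : 0 < μ₀)
    (hLip : ∀ k x y, ‖gJ k x - gJ k y‖ ≤ L * ‖x - y‖)
    (hmono : ∀ k x y, m * ‖x - y‖ ^ 2 ≤ inner ℝ (gJ k x - gJ k y) (x - y))
    (hcoc : ∀ k x y, ‖gp k x - gp k y‖ ^ 2 ≤ P * inner ℝ (gp k x - gp k y) (x - y)) :
    ∃ C : ℝ, 0 ≤ C ∧ ∀ (η μ : ℝ) (wo : EuclideanSpace ℝ (Fin M))
      (φ ζ ψ : K → EuclideanSpace ℝ (Fin M)), 0 < η → 0 < μ → μ ≤ μ₀ →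
      (∀ k, ζ k = φ k - μ • gJ k (φ k)) → (∀ k, ψ k = ζ k - (μ * η) • gp k (ζ k)) →
      ∑ k, φ k = ∑ k, ψ k →
      (∀ r, (∀ k, ‖ψ k - φ k‖ ≤ r) → ∀ k, ‖φ k - networkMean φ‖ ≤ κ * r) →
      ∑ k, (gJ k wo + η • gp k wo) = 0 → (∀ k, η * ‖gp k wo‖ ^ 2 ≤ B ^ 2) →
      (∀ k, ‖gJ k (φ k)‖ ≤ B₁) → (∀ k, ‖φ k - wo‖ ≤ R) → (∀ k, ‖ψ k - wo‖ ≤ R) →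
      ∀ k, ‖φ k - wo‖ ^ 2 ≤ C * (μ + (η * μ) ^ 2) ∧ ‖ψ k - wo‖ ^ 2 ≤ C * (μ + (η * μ) ^ 2) := by
  have hN : (0 : ℝ) < Fintype.card K := Nat.cast_pos.2 Fintype.card_pos
  obtain ⟨C, τ₁, hC, hτ₁, hclose⟩ := energy_closure (N := Fintype.card K) (L := L) (κ := κ)
    (B₁ := B₁) (B := B) hN hm hP hμ₀
  refine ⟨(4 * κ ^ 2 + 6) * C + R ^ 2 / τ₁ ^ 2, by positivity,
    fun η μ wo φ ζ ψ hη hμ hμle hζ hψ hsum hdis hopt hpen hB₁ hφR hψR k => ?_⟩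
  have hr0 : 0 ≤ μ + (η * μ) ^ 2 := by positivity
  rcases le_or_gt (η * μ) τ₁ with hτ | hτ
  · obtain ⟨S, hS⟩ : ∃ y, y = ∑ k, ‖gp k (ζ k) - gp k wo‖ ^ 2 := ⟨_, rfl⟩
    have hS0 : 0 ≤ S := hS ▸ Finset.sum_nonneg fun _ _ => sq_nonneg _
    obtain ⟨Γ, hΓ⟩ : ∃ y, y = 3 * (B₁ ^ 2 + η * B ^ 2 + η ^ 2 * S) := ⟨_, rfl⟩
    have hΓ0 : 0 ≤ Γ := by rw [hΓ]; positivity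
    have hstep : ∀ k, ψ k - φ k = -(μ • (gJ k (φ k) + η • gp k (ζ k))) := fun k => by
      have h1 : ψ k = φ k - μ • gJ k (φ k) - (μ * η) • gp k (ζ k) := by rw [hψ k, ← hζ k]
      rw [h1, smul_add, smul_smul]
      abel
    have hG : ∀ k, ‖gJ k (φ k) + η • gp k (ζ k)‖ ^ 2 ≤ Γ := fun k => by
      rw [hΓ]
      exact norm_add_smul_sq_le hη (hB₁ k) (hpen k) (hS ▸
        Finset.single_le_sum (f := fun k => ‖gp k (ζ k) - gp k wo‖ ^ 2)
          (fun _ _ => by positivity) (Finset.mem_univ k))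
    have hstepn : ∀ k, ‖ψ k - φ k‖ ≤ μ * √Γ := fun k => by
      rw [hstep k, norm_neg, norm_smul, Real.norm_of_nonneg hμ.le]
      exact mul_le_mul_of_nonneg_left (Real.le_sqrt_of_sq_le (hG k)) hμ.le
    have hsq : (μ * √Γ) ^ 2 = μ ^ 2 * Γ := by rw [mul_pow, Real.sq_sqrt hΓ0]
    have hstepsq : ‖ψ k - φ k‖ ^ 2 ≤ μ ^ 2 * Γ :=
      hsq ▸ pow_le_pow_left₀ (norm_nonneg _) (hstepn k) 2
    have hQ : ∀ k, ‖φ k - networkMean φ‖ ^ 2 ≤ κ ^ 2 * (μ ^ 2 * Γ) := fun k => by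
      have h1 := pow_le_pow_left₀ (norm_nonneg _) (hdis _ hstepn k) 2
      rwa [mul_pow, hsq] at h1
    have hzero : ∑ k, (gJ k (φ k) + η • gp k (ζ k)) = 0 := by
      have h1 : ∑ k, (ψ k - φ k) = 0 := by rw [Finset.sum_sub_distrib, hsum, sub_self]
      simp only [hstep, Finset.sum_neg_distrib, ← Finset.smul_sum, neg_eq_zero] at h1
      exact (smul_eq_zero.1 h1).resolve_left hμ.ne'
    have hE := energy_estimate hm hP hη hLip hmono hcoc hζ hopt hzero hB₁ hQ
    rw [← hS] at hE
    have hfin := hclose η μ _ S (μ ^ 2 * Γ) hη hμ hμle hτ (sq_nonneg _) hS0 (by rw [hΓ]) hE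
    have hφ := norm_sub_sq_le_two_mul (φ k) (networkMean φ) wo
    have hψ' := norm_sub_sq_le_two_mul (ψ k) (φ k) wo
    have hQk := hQ k
    have hX0 : 0 ≤ ‖networkMean φ - wo‖ ^ 2 := sq_nonneg _
    have hq0 : 0 ≤ μ ^ 2 * Γ := mul_nonneg (sq_nonneg _) hΓ0
    generalize μ ^ 2 * Γ = q at *
    generalize ‖networkMean φ - wo‖ ^ 2 = X at *
    have hκq : 0 ≤ κ ^ 2 * q := by positivity
    have hκX : 0 ≤ κ ^ 2 * X := by positivity
    have hbig : (4 * κ ^ 2 + 6) * (X + q) ≤ ((4 * κ ^ 2 + 6) * C + R ^ 2 / τ₁ ^ 2)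
        * (μ + (η * μ) ^ 2) := by
      have h1 := mul_le_mul_of_nonneg_left hfin (by positivity : 0 ≤ 4 * κ ^ 2 + 6)
      have h2 : 0 ≤ R ^ 2 / τ₁ ^ 2 * (μ + (η * μ) ^ 2) := by positivity
      linarith
    constructor <;> linarith
  · have h1 : R ^ 2 ≤ ((4 * κ ^ 2 + 6) * C + R ^ 2 / τ₁ ^ 2) * (μ + (η * μ) ^ 2) := by
      have h2 : τ₁ ^ 2 ≤ μ + (η * μ) ^ 2 := by
        have := pow_le_pow_left₀ hτ₁.le hτ.le 2
        linarith
      have h3 : 0 ≤ (4 * κ ^ 2 + 6) * C * (μ + (η * μ) ^ 2) := by positivity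
      have h4 : R ^ 2 = R ^ 2 / τ₁ ^ 2 * τ₁ ^ 2 := by field_simp
      have h5 := mul_le_mul_of_nonneg_left h2 (by positivity : 0 ≤ R ^ 2 / τ₁ ^ 2)
      linarith
    exact ⟨(pow_le_pow_left₀ (norm_nonneg _) (hφR k) 2).trans h1,
      (pow_le_pow_left₀ (norm_nonneg _) (hψR k) 2).trans h1⟩

/-! ### The stochastic recursion -/

section Probability

variable {Ω : Type*} {mΩ : MeasurableSpace Ω} {P : Measure Ω}

theorem memLp_comp_of_norm_sub_le {E F : Type*} [NormedAddCommGroup E] [NormedAddCommGroup F]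
    [IsFiniteMeasure P] {T : E → F} (hT : Continuous T) {c : ℝ}
    (hc : ∀ x y, ‖T x - T y‖ ≤ c * ‖x - y‖) {X : Ω → E} (hX : MemLp X 2 P) :
    MemLp (fun ω => T (X ω)) 2 P := by
  have h1 : MemLp (fun ω => T (X ω) - T 0) 2 P :=
    hX.of_le_mul (c := c) ((hT.comp_aestronglyMeasurable hX.1).sub aestronglyMeasurable_const)
      (Filter.Eventually.of_forall fun ω => by simpa using hc (X ω) 0)
  simpa [Pi.add_def] using h1.add (memLp_const (T 0))

theorem integrable_inner_of_memLp {E : Type*} [NormedAddCommGroup E] [InnerProductSpace ℝ E]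
    {X V : Ω → E} (hX : MemLp X 2 P) (hV : MemLp V 2 P) :
    Integrable (fun ω => inner ℝ (X ω) (V ω)) P := by
  refine (hX.norm.integrable_mul hV.norm).mono (hX.1.inner hV.1)
    (Filter.Eventually.of_forall fun ω => ?_)
  simpa using abs_real_inner_le_norm (X ω) (V ω)

/-- A square-integrable random vector that is known at time `i` is orthogonal to noise of zero
conditional mean. -/
theorem integral_inner_eq_zero_of_condExp_eq_zero {E : Type*} [NormedAddCommGroup E]
    [InnerProductSpace ℝ E] [CompleteSpace E] [IsFiniteMeasure P] {m : MeasurableSpace Ω}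
    (hm : m ≤ mΩ) {X V : Ω → E} (hXm : AEStronglyMeasurable[m] X P) (hX : MemLp X 2 P)
    (hV : MemLp V 2 P) (hcond : P[V | m] =ᵐ[P] 0) : ∫ ω, inner ℝ (X ω) (V ω) ∂P = 0 := by
  have hint : Integrable (fun ω => inner ℝ (X ω) (V ω)) P := integrable_inner_of_memLp hX hV
  have h1 := condExp_bilin_of_aestronglyMeasurable_left (m := m) (innerSL ℝ : E →L[ℝ] E →L[ℝ] ℝ)
    hXm hint (hV.integrable (by norm_num))
  rw [← integral_condExp hm]
  refine (integral_congr_ae ?_).trans (integral_zero Ω ℝ)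
  filter_upwards [h1, hcond] with ω h2 h3
  refine h2.trans ?_
  rw [h3]
  simp

theorem integrable_norm_sub_sq {E : Type*} [NormedAddCommGroup E] [IsFiniteMeasure P]
    {X : Ω → E} (hX : MemLp X 2 P) (z : E) :
    Integrable (fun ω => ‖X ω - z‖ ^ 2) P :=
  (hX.sub (memLp_const z)).integrable_norm_pow (by norm_num)

end Probability

section History

variable {K Ω : Type*} {M : ℕ} {w : ℕ → K → Ω → EuclideanSpace ℝ (Fin M)}

theorem measurable_history {i j : ℕ} (hij : j ≤ i) (k : K) : Measurable[history w i] (w j k) :=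
  (comap_measurable (w j k)).mono (le_iSup_of_le j (le_iSup_of_le hij
    (le_iSup (fun k => MeasurableSpace.comap (w j k) inferInstance) k))) le_rfl

theorem history_le {mΩ : MeasurableSpace Ω} {i : ℕ} (h : ∀ j ≤ i, ∀ k, Measurable (w j k)) :
    history w i ≤ mΩ :=
  iSup_le fun j => iSup_le fun hj => iSup_le fun k => (h j hj k).comap_le

end History

section Lipschitz

variable {K : Type*} {M : ℕ} {J p : K → EuclideanSpace ℝ (Fin M) → ℝ} {lmin lmax lp : K → ℝ}

theorem NetworkRegularity.exists_lipschitz_cost (hreg : NetworkRegularity J p lmin lmax lp) (k : K)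
    (t : ℝ) : ∃ c : ℝ, ∀ x y, ‖(x - t • grad (J k) x) - (y - t • grad (J k) y)‖ ≤ c * ‖x - y‖ :=
  ⟨_, (hreg.cost k).norm_gradStep_sub_le (hreg.cost_ge k) (hreg.cost_le k) (le_max_left _ _)
    (le_max_right _ _)⟩

theorem NetworkRegularity.exists_lipschitz_pen (hreg : NetworkRegularity J p lmin lmax lp) (k : K)
    (t : ℝ) : ∃ c : ℝ, ∀ x y, ‖(x - t • grad (p k) x) - (y - t • grad (p k) y)‖ ≤ c * ‖x - y‖ :=
  ⟨_, (hreg.pen k).norm_gradStep_sub_le (hreg.pen_ge k) (hreg.pen_le k) (le_max_left _ _)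
    (le_max_right _ _)⟩

end Lipschitz

section Run

variable {K : Type*} [Fintype K] {M : ℕ} {J p : K → EuclideanSpace ℝ (Fin M) → ℝ}
  {lmin lmax lp : K → ℝ} {A₁ A₂ : Matrix K K ℝ} {α σ μ η : ℝ}
  {Ω : Type*}
  {v : ℕ → K → EuclideanSpace ℝ (Fin M) → Ω → EuclideanSpace ℝ (Fin M)}
  {w : ℕ → K → Ω → EuclideanSpace ℝ (Fin M)}

theorem measurable_combine {m : MeasurableSpace Ω} (B : Matrix K K ℝ)
    {x : K → Ω → EuclideanSpace ℝ (Fin M)} (hx : ∀ k, Measurable[m] (x k)) (k : K) :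
    Measurable[m] (fun ω => combine B (fun l => x l ω) k) := by
  unfold combine
  exact Finset.measurable_sum _ fun l _ => (hx l).const_smul (B l k)

/-- The point reached by agent `k` at time `i + 1` after the noisy gradient step on its cost. -/
noncomputable def noisyCostStep (J : K → EuclideanSpace ℝ (Fin M) → ℝ) (A₁ : Matrix K K ℝ) (μ : ℝ)
    (v : ℕ → K → EuclideanSpace ℝ (Fin M) → Ω → EuclideanSpace ℝ (Fin M))
    (w : ℕ → K → Ω → EuclideanSpace ℝ (Fin M)) (i : ℕ) (k : K) (ω : Ω) :
    EuclideanSpace ℝ (Fin M) :=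
  (combine A₁ (fun l => w i l ω) k - μ • grad (J k) (combine A₁ (fun l => w i l ω) k))
    - μ • v (i + 1) k (combine A₁ (fun l => w i l ω) k) ω

theorem recursion_eq {i : ℕ} {ω : Ω} (hrec : (fun k => w (i + 1) k ω) =
      diffusionStep J p A₁ A₂ μ η (fun k y => v (i + 1) k y ω) (fun k => w i k ω)) (k : K) :
    w (i + 1) k ω = combine A₂ (fun l => noisyCostStep J A₁ μ v w i l ω
      - (μ * η) • grad (p l) (noisyCostStep J A₁ μ v w i l ω)) k := by
  rw [show w (i + 1) k ω = (fun k => w (i + 1) k ω) k from rfl, hrec]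
  simp only [diffusionStep, noisyCostStep, smul_add, sub_add_eq_sub_sub]

variable [mΩ : MeasurableSpace Ω] {P : Measure Ω}

theorem memLp_combine (B : Matrix K K ℝ) {x : K → Ω → EuclideanSpace ℝ (Fin M)}
    (hx : ∀ k, MemLp (x k) 2 P) (k : K) :
    MemLp (fun ω => combine B (fun l => x l ω) k) 2 P := by
  unfold combine
  exact memLp_finsetSum _ fun l _ => (hx l).const_smul (B l k)

variable [IsProbabilityMeasure P]

theorem measurable_memLp_noisyCostStep (hreg : NetworkRegularity J p lmin lmax lp)
    (hnoise : IsGradientNoise P w v α σ) {i : ℕ}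
    (hw : ∀ j ≤ i, ∀ k, Measurable (w j k) ∧ MemLp (w j k) 2 P) (k : K) :
    Measurable (noisyCostStep J A₁ μ v w i k) ∧ MemLp (noisyCostStep J A₁ μ v w i k) 2 P := by
  have hφm := measurable_combine (m := mΩ) A₁ (fun k => (hw i le_rfl k).1) k
  have hφL := memLp_combine A₁ (fun k => (hw i le_rfl k).2) k
  obtain ⟨h1, h2, -, -⟩ := hnoise i k _
    (measurable_combine A₁ (fun k => measurable_history le_rfl k) k) hφL
  obtain ⟨c, hc⟩ := hreg.exists_lipschitz_cost k μ
  have hcont : Continuous fun x => x - μ • grad (J k) x :=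
    continuous_id.sub ((hreg.cost k).continuous_grad.const_smul μ)
  exact ⟨(hcont.measurable.comp hφm).sub (h1.const_smul μ),
    (memLp_comp_of_norm_sub_le hcont hc hφL).sub (h2.const_smul μ)⟩

theorem measurable_memLp_iterates (hreg : NetworkRegularity J p lmin lmax lp)
    (hnoise : IsGradientNoise P w v α σ) (hw0 : ∀ k, Measurable (w 0 k))
    (hw0L : ∀ k, MemLp (w 0 k) 2 P)
    (hrec : ∀ i ω, (fun k => w (i + 1) k ω) =
      diffusionStep J p A₁ A₂ μ η (fun k y => v (i + 1) k y ω) (fun k => w i k ω)) (i : ℕ) (k : K) :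
    Measurable (w i k) ∧ MemLp (w i k) 2 P := by
  induction i using Nat.strong_induction_on generalizing k with
  | _ i ih =>
    rcases i with _ | i
    · exact ⟨hw0 k, hw0L k⟩
    have hζ := fun k => measurable_memLp_noisyCostStep (J := J) (A₁ := A₁) (μ := μ) hreg hnoise
      (fun j hj k => ih j (Nat.lt_succ_of_le hj) k) k
    have heq : w (i + 1) k = fun ω => combine A₂ (fun l => noisyCostStep J A₁ μ v w i l ω
        - (μ * η) • grad (p l) (noisyCostStep J A₁ μ v w i l ω)) k :=
      funext fun ω => recursion_eq (hrec i ω) k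
    have hcont : ∀ l, Continuous fun x => x - (μ * η) • grad (p l) x := fun l =>
      continuous_id.sub ((hreg.pen l).continuous_grad.const_smul (μ * η))
    rw [heq]
    refine ⟨measurable_combine A₂ (fun l => (hcont l).measurable.comp (hζ l).1) k,
      memLp_combine A₂ (fun l => ?_) k⟩
    obtain ⟨c, hc⟩ := hreg.exists_lipschitz_pen l (μ * η)
    exact memLp_comp_of_norm_sub_le (hcont l) hc (hζ l).2

/-- The noisy gradient step of one agent contracts the mean-square distance to the noise-free step
of a fixed reference point `y`, up to a term of second order in the step-size: the cross term
vanishes because the noise has zero conditional mean. -/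
theorem integral_noisyCostStep_sub_sq_le (hα : 0 ≤ α) (hreg : NetworkRegularity J p lmin lmax lp)
    (hnoise : IsGradientNoise P w v α σ) {i : ℕ}
    (hw : ∀ j ≤ i, ∀ k, Measurable (w j k) ∧ MemLp (w j k) 2 P) {k : K} {γ : ℝ}
    (h₁ : |1 - μ * lmin k| ≤ γ) (h₂ : |1 - μ * lmax k| ≤ γ) (y : EuclideanSpace ℝ (Fin M)) :
    ∫ ω, ‖noisyCostStep J A₁ μ v w i k ω - (y - μ • grad (J k) y)‖ ^ 2 ∂P
      ≤ (γ ^ 2 + 2 * α * μ ^ 2) * ∫ ω, ‖combine A₁ (fun l => w i l ω) k - y‖ ^ 2 ∂P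
        + μ ^ 2 * (2 * α * ‖y‖ ^ 2 + σ ^ 2) := by
  set φ : Ω → EuclideanSpace ℝ (Fin M) := fun ω => combine A₁ (fun l => w i l ω) k with hφ
  have hφH : Measurable[history w i] φ :=
    measurable_combine A₁ (fun k => measurable_history le_rfl k) k
  have hφL : MemLp φ 2 P := memLp_combine A₁ (fun k => (hw i le_rfl k).2) k
  obtain ⟨-, hVL, hVc, hVb⟩ := hnoise i k φ hφH hφL
  set V : Ω → EuclideanSpace ℝ (Fin M) := fun ω => v (i + 1) k (φ ω) ω with hV
  have hcont : Continuous fun x => x - μ • grad (J k) x - (y - μ • grad (J k) y) :=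
    (continuous_id.sub ((hreg.cost k).continuous_grad.const_smul μ)).sub continuous_const
  have hγ : ∀ x, ‖x - μ • grad (J k) x - (y - μ • grad (J k) y)‖ ≤ γ * ‖x - y‖ := fun x =>
    (hreg.cost k).norm_gradStep_sub_le (hreg.cost_ge k) (hreg.cost_le k) h₁ h₂ x y
  set X : Ω → EuclideanSpace ℝ (Fin M) :=
    fun ω => φ ω - μ • grad (J k) (φ ω) - (y - μ • grad (J k) y) with hX
  have hXH : AEStronglyMeasurable[history w i] X P :=
    (hcont.measurable.comp hφH).stronglyMeasurable.aestronglyMeasurable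
  have hXL : MemLp X 2 P := by
    refine memLp_comp_of_norm_sub_le (c := γ) hcont (fun a b => ?_) hφL
    rw [sub_sub_sub_cancel_right]
    exact (hreg.cost k).norm_gradStep_sub_le (hreg.cost_ge k) (hreg.cost_le k) h₁ h₂ a b
  have horth := integral_inner_eq_zero_of_condExp_eq_zero
    (history_le fun j hj k => (hw j hj k).1) hXH hXL hVL hVc
  have hX2 : Integrable (fun ω => ‖X ω‖ ^ 2) P := hXL.integrable_norm_pow (by norm_num)
  have hV2 : Integrable (fun ω => ‖V ω‖ ^ 2) P := hVL.integrable_norm_pow (by norm_num)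
  have hφ2 : Integrable (fun ω => ‖φ ω - y‖ ^ 2) P := integrable_norm_sub_sq hφL y
  have hφ0 : Integrable (fun ω => ‖φ ω‖ ^ 2) P := hφL.integrable_norm_pow (by norm_num)
  have hXV : Integrable (fun ω => inner ℝ (X ω) (V ω)) P := integrable_inner_of_memLp hXL hVL
  have hexp : ∀ ω, ‖noisyCostStep J A₁ μ v w i k ω - (y - μ • grad (J k) y)‖ ^ 2
      = ‖X ω‖ ^ 2 - 2 * μ * inner ℝ (X ω) (V ω) + μ ^ 2 * ‖V ω‖ ^ 2 := fun ω => by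
    have e : noisyCostStep J A₁ μ v w i k ω - (y - μ • grad (J k) y) = X ω - μ • V ω := by
      simp only [noisyCostStep, hX, hV, hφ]; abel
    rw [e, norm_sub_sq_real, inner_smul_right, norm_smul, mul_pow, Real.norm_eq_abs, sq_abs]
    ring
  have hXle : ∫ ω, ‖X ω‖ ^ 2 ∂P ≤ γ ^ 2 * ∫ ω, ‖φ ω - y‖ ^ 2 ∂P := by
    rw [← integral_const_mul]
    refine integral_mono hX2 (hφ2.const_mul _) fun ω => ?_
    have h := pow_le_pow_left₀ (norm_nonneg _) (hγ (φ ω)) 2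
    rwa [mul_pow] at h
  have hφle : ∫ ω, ‖φ ω‖ ^ 2 ∂P ≤ 2 * ∫ ω, ‖φ ω - y‖ ^ 2 ∂P + 2 * ‖y‖ ^ 2 := by
    calc ∫ ω, ‖φ ω‖ ^ 2 ∂P ≤ ∫ ω, (2 * ‖φ ω - y‖ ^ 2 + 2 * ‖y‖ ^ 2) ∂P :=
          integral_mono hφ0 ((hφ2.const_mul _).add (integrable_const _)) fun ω => by
            simpa using norm_sub_sq_le_two_mul (φ ω) y 0
      _ = _ := by
          rw [integral_add (hφ2.const_mul _) (integrable_const _), integral_const_mul]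
          simp
  have hsub : Integrable (fun ω => ‖X ω‖ ^ 2 - 2 * μ * inner ℝ (X ω) (V ω)) P :=
    hX2.sub (hXV.const_mul _)
  simp only [hexp]
  rw [integral_add hsub (hV2.const_mul _), integral_sub hX2 (hXV.const_mul _),
    integral_const_mul, integral_const_mul, horth, mul_zero, sub_zero]
  have h3 : μ ^ 2 * ∫ ω, ‖V ω‖ ^ 2 ∂P
      ≤ μ ^ 2 * (α * (2 * ∫ ω, ‖φ ω - y‖ ^ 2 ∂P + 2 * ‖y‖ ^ 2) + σ ^ 2) :=
    mul_le_mul_of_nonneg_left (hVb.trans (add_le_add (mul_le_mul_of_nonneg_left hφle hα) le_rfl))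
      (sq_nonneg μ)
  linarith

variable [DecidableEq K]

/-- The mean-square deviation of the network from the fixed point of the noise-free recursion
contracts in each iteration, up to the power of the noise. -/
theorem sum_integral_sub_sq_succ_le (hα : 0 ≤ α) (hμ : 0 < μ) (hη : 0 < η)
    (hA₁ : A₁ ∈ doublyStochastic ℝ K) (hA₂ : A₂ ∈ doublyStochastic ℝ K)
    (hreg : NetworkRegularity J p lmin lmax lp)
    (hnoise : IsGradientNoise P w v α σ) (hw0 : ∀ k, Measurable (w 0 k))
    (hw0L : ∀ k, MemLp (w 0 k) 2 P)
    (hrec : ∀ i ω, (fun k => w (i + 1) k ω) =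
      diffusionStep J p A₁ A₂ μ η (fun k y => v (i + 1) k y ω) (fun k => w i k ω))
    {γ F : ℝ} (h₁ : ∀ k, |1 - μ * lmin k| ≤ γ) (h₂ : ∀ k, |1 - μ * lmax k| ≤ γ)
    (hlp : ∀ k, η * μ * lp k ≤ 2) {winf : K → EuclideanSpace ℝ (Fin M)}
    (hfix : diffusionStep J p A₁ A₂ μ η 0 winf = winf)
    (hF : ∀ k, ‖combine A₁ winf k‖ ^ 2 ≤ F) (i : ℕ) :
    ∑ k, ∫ ω, ‖w (i + 1) k ω - winf k‖ ^ 2 ∂P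
      ≤ (γ ^ 2 + 2 * α * μ ^ 2) * ∑ k, ∫ ω, ‖w i k ω - winf k‖ ^ 2 ∂P
        + Fintype.card K * (μ ^ 2 * (2 * α * F + σ ^ 2)) := by
  have hwall := measurable_memLp_iterates hreg hnoise hw0 hw0L hrec
  have hζ := fun k => measurable_memLp_noisyCostStep (J := J) (A₁ := A₁) (μ := μ) hreg hnoise
    (fun j (_ : j ≤ i) k => hwall j k) k
  set y := combine A₁ winf with hy
  set z : K → EuclideanSpace ℝ (Fin M) := fun k => y k - μ • grad (J k) (y k) with hz
  have hφL : ∀ k, MemLp (fun ω => combine A₁ (fun l => w i l ω) k) 2 P := fun k =>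
    memLp_combine A₁ (fun k => (hwall i k).2) k
  have hpoint : ∀ ω, ∑ k, ‖w (i + 1) k ω - winf k‖ ^ 2
      ≤ ∑ k, ‖noisyCostStep J A₁ μ v w i k ω - z k‖ ^ 2 := by
    intro ω
    have hwinf : ∀ k, winf k = combine A₂ (fun l => z l - (μ * η) • grad (p l) (z l)) k := by
      intro k
      conv_lhs => rw [← hfix, diffusionStep_zero]
      rfl
    calc ∑ k, ‖w (i + 1) k ω - winf k‖ ^ 2
        = ∑ k, ‖combine A₂ (fun l => (noisyCostStep J A₁ μ v w i l ω
            - (μ * η) • grad (p l) (noisyCostStep J A₁ μ v w i l ω))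
            - (z l - (μ * η) • grad (p l) (z l))) k‖ ^ 2 := by
          refine Finset.sum_congr rfl fun k _ => ?_
          rw [hwinf k, recursion_eq (hrec i ω) k, combine_sub]
      _ ≤ _ := sum_norm_combine_sq_le hA₂ _
      _ ≤ _ := Finset.sum_le_sum fun l _ => pow_le_pow_left₀ (norm_nonneg _)
          (hreg.norm_penaltyStep_sub_le hμ hη (hlp l) _ _) 2
  have hpoint' : ∀ ω, ∑ k, ‖combine A₁ (fun l => w i l ω) k - y k‖ ^ 2
      ≤ ∑ k, ‖w i k ω - winf k‖ ^ 2 := by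
    intro ω
    simp only [hy, combine_sub]
    exact sum_norm_combine_sq_le hA₁ _
  have hβ : 0 ≤ γ ^ 2 + 2 * α * μ ^ 2 := by positivity
  calc ∑ k, ∫ ω, ‖w (i + 1) k ω - winf k‖ ^ 2 ∂P
      = ∫ ω, ∑ k, ‖w (i + 1) k ω - winf k‖ ^ 2 ∂P :=
        (integral_finsetSum _ fun k _ => integrable_norm_sub_sq (hwall _ k).2 _).symm
    _ ≤ ∫ ω, ∑ k, ‖noisyCostStep J A₁ μ v w i k ω - z k‖ ^ 2 ∂P :=
        integral_mono (integrable_finsetSum _ fun k _ => integrable_norm_sub_sq (hwall _ k).2 _)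
          (integrable_finsetSum _ fun k _ => integrable_norm_sub_sq (hζ k).2 _) hpoint
    _ = ∑ k, ∫ ω, ‖noisyCostStep J A₁ μ v w i k ω - z k‖ ^ 2 ∂P :=
        integral_finsetSum _ fun k _ => integrable_norm_sub_sq (hζ k).2 _
    _ ≤ ∑ k, ((γ ^ 2 + 2 * α * μ ^ 2) * ∫ ω, ‖combine A₁ (fun l => w i l ω) k - y k‖ ^ 2 ∂P
          + μ ^ 2 * (2 * α * F + σ ^ 2)) := by
        refine Finset.sum_le_sum fun k _ => (integral_noisyCostStep_sub_sq_le hα hreg hnoise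
          (fun j _ k => hwall j k) (h₁ k) (h₂ k) (y k)).trans (add_le_add le_rfl ?_)
        have := mul_le_mul_of_nonneg_left (hF k) (by positivity : 0 ≤ 2 * α)
        exact mul_le_mul_of_nonneg_left (by linarith) (sq_nonneg μ)
    _ = (γ ^ 2 + 2 * α * μ ^ 2) * ∫ ω, ∑ k, ‖combine A₁ (fun l => w i l ω) k - y k‖ ^ 2 ∂P
          + Fintype.card K * (μ ^ 2 * (2 * α * F + σ ^ 2)) := by
        rw [Finset.sum_add_distrib, ← Finset.mul_sum, Finset.sum_const, Finset.card_univ,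
          nsmul_eq_mul, integral_finsetSum _ fun k _ => integrable_norm_sub_sq (hφL k) _]
    _ ≤ (γ ^ 2 + 2 * α * μ ^ 2) * ∫ ω, ∑ k, ‖w i k ω - winf k‖ ^ 2 ∂P
          + Fintype.card K * (μ ^ 2 * (2 * α * F + σ ^ 2)) := by
        refine add_le_add (mul_le_mul_of_nonneg_left (integral_mono ?_ ?_ hpoint') hβ) le_rfl
        · exact integrable_finsetSum _ fun k _ => integrable_norm_sub_sq (hφL k) _
        · exact integrable_finsetSum _ fun k _ => integrable_norm_sub_sq (hwall _ k).2 _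
    _ = _ := by rw [integral_finsetSum _ fun k _ => integrable_norm_sub_sq (hwall _ k).2 _]

end Run

theorem le_pow_mul_add_of_succ_le {e : ℕ → ℝ} {β c : ℝ} (hβ0 : 0 ≤ β) (hβ1 : β < 1)
    (he : ∀ i, e (i + 1) ≤ β * e i + c) (hc : 0 ≤ c) (i : ℕ) :
    e i ≤ β ^ i * e 0 + c / (1 - β) := by
  have h1 : 0 < 1 - β := by linarith
  induction i with
  | zero => have := div_nonneg hc h1.le; simp; linarith
  | succ i ih =>
    have h2 := mul_le_mul_of_nonneg_left ih hβ0
    have h3 : c / (1 - β) = β * (c / (1 - β)) + c := by field_simp; ring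
    calc e (i + 1) ≤ β * (β ^ i * e 0 + c / (1 - β)) + c := (he i).trans (by linarith)
      _ = β ^ (i + 1) * e 0 + (β * (c / (1 - β)) + c) := by ring
      _ = _ := by rw [← h3]

/-- The steady-state mean-square error is at most twice the squared bias of the fixed point plus a
noise term of first order in the step-size. -/
theorem DiffusionRun.limsupMSE_le {K : Type*} [Fintype K] [DecidableEq K] {M : ℕ}
    {J p : K → EuclideanSpace ℝ (Fin M) → ℝ} {lmin lmax lp : K → ℝ} {A₁ A₂ : Matrix K K ℝ}
    {α σ μ η : ℝ} (R : DiffusionRun.{u} J p A₁ A₂ α σ μ η) (hα : 0 ≤ α) (hμ : 0 < μ) (hη : 0 < η)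
    (hA₁ : A₁ ∈ doublyStochastic ℝ K) (hA₂ : A₂ ∈ doublyStochastic ℝ K)
    (hreg : NetworkRegularity J p lmin lmax lp)
    {γ c F : ℝ} (h₁ : ∀ k, |1 - μ * lmin k| ≤ γ) (h₂ : ∀ k, |1 - μ * lmax k| ≤ γ)
    (hc : 0 < c) (hrate : γ ^ 2 + 2 * α * μ ^ 2 ≤ 1 - c * μ)
    (hlp : ∀ k, η * μ * lp k ≤ 2) {winf : K → EuclideanSpace ℝ (Fin M)}
    (hfix : diffusionStep J p A₁ A₂ μ η 0 winf = winf)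
    (hF0 : 0 ≤ F) (hF : ∀ k, ‖combine A₁ winf k‖ ^ 2 ≤ F) (z : EuclideanSpace ℝ (Fin M)) (k : K) :
    R.limsupMSE z k ≤ ENNReal.ofReal (2 * ‖winf k - z‖ ^ 2
      + 2 * (Fintype.card K * (2 * α * F + σ ^ 2) / c) * μ) := by
  obtain ⟨Ω, P, v, w, hw0, hw0L, hnoise, hrec⟩ := R
  unfold DiffusionRun.limsupMSE
  dsimp only
  have hwall := measurable_memLp_iterates hreg hnoise hw0 hw0L hrec
  set β := γ ^ 2 + 2 * α * μ ^ 2 with hβ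
  have hβ0 : 0 ≤ β := by positivity
  have hcμ : 0 < c * μ := mul_pos hc hμ
  have hβ1 : β < 1 := by linarith
  set C := Fintype.card K * (μ ^ 2 * (2 * α * F + σ ^ 2)) with hC
  have hC0 : 0 ≤ C := by positivity
  set e : ℕ → ℝ := fun i => ∑ k, ∫ ω, ‖w i k ω - winf k‖ ^ 2 ∂P with he
  have hei := le_pow_mul_add_of_succ_le (e := e) hβ0 hβ1
    (sum_integral_sub_sq_succ_le hα hμ hη hA₁ hA₂ hreg hnoise hw0 hw0L hrec h₁ h₂ hlp hfix hF) hC0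
  have hbound : ∀ i, ∫⁻ ω, ‖z - w i k ω‖ₑ ^ 2 ∂P
      ≤ ENNReal.ofReal (2 * (β ^ i * e 0 + C / (1 - β)) + 2 * ‖winf k - z‖ ^ 2) := by
    intro i
    have hint := integrable_norm_sub_sq (hwall i k).2 z
    have hint' := integrable_norm_sub_sq (hwall i k).2 (winf k)
    have e1 : ∫⁻ ω, ‖z - w i k ω‖ₑ ^ 2 ∂P = ENNReal.ofReal (∫ ω, ‖w i k ω - z‖ ^ 2 ∂P) := by
      rw [ofReal_integral_eq_lintegral_ofReal hint
        (Filter.Eventually.of_forall fun ω => sq_nonneg _)]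
      refine lintegral_congr fun ω => ?_
      rw [ENNReal.ofReal_pow (norm_nonneg _), ofReal_norm, ← enorm_neg, neg_sub]
    rw [e1]
    refine ENNReal.ofReal_le_ofReal ?_
    have h3 : ∫ ω, ‖w i k ω - z‖ ^ 2 ∂P
        ≤ 2 * ∫ ω, ‖w i k ω - winf k‖ ^ 2 ∂P + 2 * ‖winf k - z‖ ^ 2 := by
      calc ∫ ω, ‖w i k ω - z‖ ^ 2 ∂P
          ≤ ∫ ω, (2 * ‖w i k ω - winf k‖ ^ 2 + 2 * ‖winf k - z‖ ^ 2) ∂P :=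
            integral_mono hint ((hint'.const_mul _).add (integrable_const _)) fun ω =>
              norm_sub_sq_le_two_mul _ _ _
        _ = _ := by
            rw [integral_add (hint'.const_mul _) (integrable_const _), integral_const_mul]
            simp
    have h4 : ∫ ω, ‖w i k ω - winf k‖ ^ 2 ∂P ≤ e i :=
      Finset.single_le_sum (f := fun k => ∫ ω, ‖w i k ω - winf k‖ ^ 2 ∂P)
        (fun _ _ => integral_nonneg fun _ => sq_nonneg _) (Finset.mem_univ k)
    linarith [hei i]
  have hlim : Tendsto (fun i : ℕ =>
      ENNReal.ofReal (2 * (β ^ i * e 0 + C / (1 - β)) + 2 * ‖winf k - z‖ ^ 2)) atTop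
      (𝓝 (ENNReal.ofReal (2 * (0 * e 0 + C / (1 - β)) + 2 * ‖winf k - z‖ ^ 2))) :=
    ENNReal.tendsto_ofReal (((((tendsto_pow_atTop_nhds_zero_of_lt_one hβ0 hβ1).mul_const
      (e 0)).add_const _).const_mul 2).add_const _)
  refine (limsup_le_limsup (Filter.Eventually.of_forall hbound)).trans ?_
  rw [hlim.limsup_eq]
  refine ENNReal.ofReal_le_ofReal ?_
  have h5 : C / (1 - β) ≤ C / (c * μ) := div_le_div_of_nonneg_left hC0 hcμ (by linarith)
  have h6 : C / (c * μ) = Fintype.card K * (2 * α * F + σ ^ 2) / c * μ := by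
    rw [hC]; field_simp
  linarith

/-! ### The steady-state error -/

/-- The a priori bounds from which all constants of the error analysis are computed: `wo` minimizes
the penalized cost, and `z` is a point close to `wo` that the noise-free adaptation of each agent
moves by at most `μ B`. For a feasible problem `z` is taken feasible, and then `B` does not depend
on `η`; otherwise `z = wo`. -/
structure ReferenceBound {K : Type*} [Fintype K] {M : ℕ} (J p : K → EuclideanSpace ℝ (Fin M) → ℝ)
    (η : ℝ) (wo z : EuclideanSpace ℝ (Fin M)) (B : ℝ) : Prop where
  opt : ∑ k, (grad (J k) wo + η • grad (p k) wo) = 0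
  norm_le : ‖z‖ ≤ B
  norm_sub_le : ‖wo - z‖ ≤ B
  grad_le : ∀ k, ‖grad (J k) z‖ + η * ‖grad (p k) z‖ ≤ B
  grad_pen_le : ∀ k, η * ‖grad (p k) wo‖ ^ 2 ≤ B ^ 2

theorem NetworkRegularity.norm_adaptStep_self_sub_le {K : Type*} {M : ℕ}
    {J p : K → EuclideanSpace ℝ (Fin M) → ℝ} {lmin lmax lp : K → ℝ}
    (hreg : NetworkRegularity J p lmin lmax lp)
    {μ η : ℝ} (hμ : 0 < μ) (hη : 0 < η) {k : K} (hlp : η * μ * lp k ≤ 2)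
    (z : EuclideanSpace ℝ (Fin M)) :
    ‖adaptStep J p μ η k z - z‖ ≤ μ * (‖grad (J k) z‖ + η * ‖grad (p k) z‖) := by
  have h1 := hreg.norm_penaltyStep_sub_le hμ hη hlp (z - μ • grad (J k) z) z
  have h2 : adaptStep J p μ η k z - z
      = ((z - μ • grad (J k) z) - (μ * η) • grad (p k) (z - μ • grad (J k) z)
        - (z - (μ * η) • grad (p k) z)) - (μ * η) • grad (p k) z := by
    rw [adaptStep]; abel
  have h3 : ‖z - μ • grad (J k) z - z‖ = μ * ‖grad (J k) z‖ := by
    rw [sub_sub_cancel_left, norm_neg, norm_smul, Real.norm_of_nonneg hμ.le]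
  have h4 : ‖(μ * η) • grad (p k) z‖ = μ * η * ‖grad (p k) z‖ := by
    rw [norm_smul, Real.norm_of_nonneg (mul_pos hμ hη).le]
  rw [h2]
  refine (norm_sub_le _ _).trans ?_
  rw [h4]
  rw [h3] at h1
  linarith

section SteadyState

variable {K : Type*} [Fintype K] {M : ℕ} {J p : K → EuclideanSpace ℝ (Fin M) → ℝ}
  {lmin lmax lp : K → ℝ}

/-- A contraction of factor `1 - c μ / 2` that moves `z` by at most `μ B` has its fixed point within
`2 B / c` of `z`, whatever the step-size. -/
theorem norm_fixedPoint_sub_le [DecidableEq K] {A : Matrix K K ℝ}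
    (hA : A ∈ doublyStochastic ℝ K) {T : K → EuclideanSpace ℝ (Fin M) → EuclideanSpace ℝ (Fin M)}
    {γ c μ B : ℝ} (hμ : 0 < μ) (hc : 0 < c) (hB : 0 ≤ B) (hγ0 : 0 ≤ γ) (hγ : γ ≤ 1 - c * μ / 2)
    (hT : ∀ k x y, ‖T k x - T k y‖ ≤ γ * ‖x - y‖) {z : EuclideanSpace ℝ (Fin M)}
    (hz : ∀ k, ‖T k z - z‖ ≤ μ * B) {φ : K → EuclideanSpace ℝ (Fin M)}
    (hφ : ∀ k, φ k = combine A (fun l => T l (φ l)) k) (k : K) :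
    ‖φ k - z‖ ≤ 2 * B / c ∧ ‖T k (φ k) - z‖ ≤ 2 * B / c := by
  obtain ⟨X, hX⟩ : ∃ y, y = ‖fun k => φ k - z‖ := ⟨_, rfl⟩
  have hX0 : 0 ≤ X := hX ▸ norm_nonneg _
  have hle : ∀ k, ‖φ k - z‖ ≤ X := fun k => hX ▸ norm_le_pi_norm (fun k => φ k - z) k
  have hcμ : 0 < c * μ := mul_pos hc hμ
  have hT' : ∀ k, ‖T k (φ k) - z‖ ≤ γ * X + μ * B := fun k => by
    have h1 := norm_sub_le_norm_sub_add_norm_sub (T k (φ k)) (T k z) z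
    have h2 := (hT k (φ k) z).trans (mul_le_mul_of_nonneg_left (hle k) hγ0)
    linarith [hz k]
  have hXle : X ≤ γ * X + μ * B := by
    have h0 : 0 ≤ γ * X + μ * B := by positivity
    refine hX.trans_le ((pi_norm_le_iff_of_nonneg h0).2 fun k => ?_)
    rw [hφ k, ← combine_const hA z k, combine_sub]
    exact norm_combine_le hA hT' k
  have h1 := mul_le_mul_of_nonneg_right hγ hX0
  have h2 : X ≤ 2 * B / c := by
    rw [le_div_iff₀ hc]
    have h3 : μ * (X * c) ≤ μ * (2 * B) := by linarith
    exact le_of_mul_le_mul_left h3 hμ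
  have h3 : γ * X + μ * B ≤ 2 * B / c := by
    have h4 : (1 - c * μ / 2) * X ≤ (1 - c * μ / 2) * (2 * B / c) :=
      mul_le_mul_of_nonneg_left h2 (by linarith)
    have h5 : (1 - c * μ / 2) * (2 * B / c) + μ * B = 2 * B / c := by field_simp; ring
    linarith
  exact ⟨(hle k).trans h2, (hT' k).trans h3⟩

variable [DecidableEq K] [Nonempty K] {A A₁ A₂ : Matrix K K ℝ} {α σ : ℝ}

/-- The error bound, with constants that depend on `η` only through the bound `B`. The target `x` is
allowed to differ from the minimizer `wo` of the penalized cost. -/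
theorem exists_limsupMSE_bound (hreg : NetworkRegularity J p lmin lmax lp) (hα : 0 ≤ α)
    (hA : A ∈ doublyStochastic ℝ K) (hprim : A.IsPrimitive)
    (hform : (A₁ = 1 ∧ A₂ = A) ∨ (A₁ = A ∧ A₂ = 1)) (σ : ℝ) {ρ : ℝ} (hρ0 : 0 < ρ) (hρ1 : ρ < 1)
    {B : ℝ} (hB : 0 ≤ B) :
    ∃ C₁ C₂ : ℝ, ∀ (η μ : ℝ) (wo z : EuclideanSpace ℝ (Fin M)), 0 < η → 0 < μ →
      μ ≤ ρ * stepThreshold lmin lmax lp α η → ReferenceBound J p η wo z B →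
      ∀ (R : DiffusionRun.{u} J p A₁ A₂ α σ μ η) (x : EuclideanSpace ℝ (Fin M)) (k : K),
        R.limsupMSE x k ≤ ENNReal.ofReal (4 * ‖wo - x‖ ^ 2 + (C₁ * μ + C₂ * (η * μ) ^ 2)) := by
  obtain ⟨c, μ₀, hc, hμ₀, hrate⟩ := exists_contraction_rate hreg.lmin_pos hreg.lmax_pos
    hreg.lp_pos hα hρ0 hρ1
  obtain ⟨κ, hκ, hdis⟩ := exists_norm_sub_networkMean_le (M := M) hA hprim
  obtain ⟨a₁, ha₁⟩ := Finite.exists_min lmin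
  obtain ⟨a₂, ha₂⟩ := Finite.exists_max fun k => max (lmin k) (lmax k)
  obtain ⟨a₃, ha₃⟩ := Finite.exists_max lp
  set L := max (lmin a₂) (lmax a₂) with hL
  have hL0 : 0 ≤ L := (hreg.lmin_pos a₂).le.trans (le_max_left _ _)
  have hLip : ∀ k x y, ‖grad (J k) x - grad (J k) y‖ ≤ L * ‖x - y‖ := fun k =>
    (hreg.cost k).norm_grad_sub_le (hreg.cost_ge k) (hreg.cost_le k)
      (by rw [abs_of_pos (hreg.lmin_pos k)]; exact (le_max_left _ _).trans (ha₂ k))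
      (by rw [abs_of_pos (hreg.lmax_pos k)]; exact (le_max_right _ _).trans (ha₂ k))
  have hmono : ∀ k x y, lmin a₁ * ‖x - y‖ ^ 2
      ≤ inner ℝ (grad (J k) x - grad (J k) y) (x - y) := fun k x y =>
    (mul_le_mul_of_nonneg_right (ha₁ k) (sq_nonneg _)).trans
      ((hreg.cost k).mul_sq_le_inner_grad_sub (hreg.cost_ge k) x y)
  have hcoc : ∀ k x y, ‖grad (p k) x - grad (p k) y‖ ^ 2
      ≤ lp a₃ * inner ℝ (grad (p k) x - grad (p k) y) (x - y) := fun k x y => by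
    have h0 := (hreg.pen k).mul_sq_le_inner_grad_sub (hreg.pen_ge k) x y
    rw [zero_mul] at h0
    exact ((hreg.pen k).norm_grad_sub_sq_le (hreg.pen_ge k) (hreg.pen_le k) (hreg.lp_pos k) x y).trans
      (mul_le_mul_of_nonneg_right (ha₃ k) h0)
  obtain ⟨C, hC, hbias⟩ := exists_bias_bound (κ := κ) (B := B) (B₁ := B + L * (2 * B / c))
    (R := 2 * B / c + B) (hreg.lmin_pos a₁) (hreg.lp_pos a₃) hμ₀ hLip hmono hcoc
  set F := (2 * B / c + B) ^ 2 with hF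
  refine ⟨4 * C + 2 * (Fintype.card K * (2 * α * F + σ ^ 2) / c), 4 * C,
    fun η μ wo z hη hμ hle href R x k => ?_⟩
  obtain ⟨hμle, hk⟩ := hrate η μ hη hμ hle
  set γ := √(1 - c * μ - 2 * α * μ ^ 2) with hγ
  have hs : 0 ≤ 2 * α * μ ^ 2 := by positivity
  have hpos : 0 ≤ 1 - c * μ - 2 * α * μ ^ 2 := by
    have := (hk k).1
    linarith [sq_nonneg (1 - μ * lmin k)]
  have hγ0 : 0 ≤ γ := Real.sqrt_nonneg _
  have hγ2 : γ ^ 2 + 2 * α * μ ^ 2 = 1 - c * μ := by rw [hγ, Real.sq_sqrt hpos]; ring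
  have hγ1 : γ ≤ 1 - c * μ / 2 :=
    Real.sqrt_le_iff.2 ⟨by linarith, by linarith [sq_nonneg (c * μ / 2)]⟩
  have hcμ : 0 < c * μ := mul_pos hc hμ
  have h₁ : ∀ k, |1 - μ * lmin k| ≤ γ := fun k => Real.abs_le_sqrt (by linarith [(hk k).1])
  have h₂ : ∀ k, |1 - μ * lmax k| ≤ γ := fun k => Real.abs_le_sqrt (by linarith [(hk k).2.1])
  have hlp : ∀ k, η * μ * lp k ≤ 2 := fun k => (hk k).2.2
  have hadapt := fun k => hreg.norm_adaptStep_sub_le hμ hη (h₁ k) (h₂ k) (hlp k)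
  have hone : (1 : Matrix K K ℝ) ∈ doublyStochastic ℝ K := one_mem _
  have hA₁ : A₁ ∈ doublyStochastic ℝ K := by rcases hform with ⟨h, -⟩ | ⟨h, -⟩ <;> rwa [h]
  have hA₂ : A₂ ∈ doublyStochastic ℝ K := by rcases hform with ⟨-, h⟩ | ⟨-, h⟩ <;> rwa [h]
  obtain ⟨winf, hfix, -⟩ := exists_fixedPoint_diffusionStep (J := J) (p := p) hA₁ hA₂ hγ0
    (by linarith) hadapt
  set φ := combine A₁ winf with hφ
  set ψ : K → EuclideanSpace ℝ (Fin M) := fun k => adaptStep J p μ η k (φ k) with hψ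
  have hwψ : winf = combine A₂ ψ := by conv_lhs => rw [← hfix, diffusionStep_zero]
  have hφψ : φ = combine A ψ := by
    rcases hform with ⟨h, h'⟩ | ⟨h, h'⟩
    · rw [hφ, h, combine_one, hwψ, h']
    · rw [hφ, h, hwψ, h', combine_one]
  have hwk : winf k = φ k ∨ winf k = ψ k := by
    rcases hform with ⟨h, -⟩ | ⟨-, h⟩
    · left; rw [hφ, h, combine_one]
    · right; rw [hwψ, h, combine_one]
  have hrad := norm_fixedPoint_sub_le hA hμ hc hB hγ0 hγ1 hadapt (z := z) (fun k =>
    (hreg.norm_adaptStep_self_sub_le hμ hη (hlp k) z).trans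
      (mul_le_mul_of_nonneg_left (href.grad_le k) hμ.le)) (φ := φ) (fun k => congrFun hφψ k)
  have hzwo : ‖z - wo‖ ≤ B := by rw [norm_sub_rev]; exact href.norm_sub_le
  have hb := hbias η μ wo φ (fun k => φ k - μ • grad (J k) (φ k)) ψ hη hμ hμle (fun _ => rfl)
    (fun _ => rfl) (by rw [hφψ, sum_combine hA])
    (fun r hr => hdis φ r fun k => by
      have e : φ k - combine A φ k = combine A (fun l => ψ l - φ l) k := by
        rw [← combine_sub, ← hφψ]
      rw [e]
      exact norm_combine_le hA hr k)
    href.opt href.grad_pen_le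
    (fun k => by
      have e1 := norm_add_le (grad (J k) (φ k) - grad (J k) z) (grad (J k) z)
      rw [sub_add_cancel] at e1
      have e2 := (hLip k (φ k) z).trans (mul_le_mul_of_nonneg_left (hrad k).1 hL0)
      have e3 := href.grad_le k
      have e4 := mul_nonneg hη.le (norm_nonneg (grad (p k) z))
      linarith)
    (fun k => (norm_sub_le_norm_sub_add_norm_sub _ z _).trans (add_le_add (hrad k).1 hzwo))
    (fun k => (norm_sub_le_norm_sub_add_norm_sub _ z _).trans (add_le_add (hrad k).2 hzwo)) k
  have hwb : ‖winf k - wo‖ ^ 2 ≤ C * (μ + (η * μ) ^ 2) := by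
    rcases hwk with h | h <;> rw [h]
    exacts [hb.1, hb.2]
  have hFb : ∀ k, ‖combine A₁ winf k‖ ^ 2 ≤ F := fun k => by
    have e1 := norm_add_le (φ k - z) z
    rw [sub_add_cancel] at e1
    exact pow_le_pow_left₀ (norm_nonneg _) (e1.trans (add_le_add (hrad k).1 href.norm_le)) 2
  refine (R.limsupMSE_le hα hμ hη hA₁ hA₂ hreg h₁ h₂ hc hγ2.le hlp hfix (sq_nonneg _) hFb x k).trans
    (ENNReal.ofReal_le_ofReal ?_)
  have := norm_sub_sq_le_two_mul (winf k) wo x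
  linarith

end SteadyState

/-! ### The minimizers of the penalized cost -/

theorem NetworkRegularity.grad_pen_eq_zero {K : Type*} {M : ℕ}
    {J p : K → EuclideanSpace ℝ (Fin M) → ℝ} {lmin lmax lp : K → ℝ} {ws : EuclideanSpace ℝ (Fin M)}
    (hreg : NetworkRegularity J p lmin lmax lp)
    (hnn : ∀ k w, 0 ≤ p k w) (hws : ∀ k, p k ws = 0) (k : K) : grad (p k) ws = 0 := by
  have h1 : IsLocalMin (p k) ws := Filter.Eventually.of_forall fun w => by
    rw [hws k]; exact hnn k w
  have h2 := h1.hasFDerivAt_eq_zero ((hreg.pen k).hasGradientAt ws).hasFDerivAt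
  exact (InnerProductSpace.toDual ℝ _).map_eq_zero_iff.1 h2

section Minimizers

variable {K : Type*} [Fintype K] {M : ℕ} {J p : K → EuclideanSpace ℝ (Fin M) → ℝ}
  {lmin lmax lp : K → ℝ}

theorem NetworkRegularity.penalizedCost_lower_bound (hreg : NetworkRegularity J p lmin lmax lp)
    {η : ℝ} (hη : 0 ≤ η) (x y : EuclideanSpace ℝ (Fin M)) :
    penalizedCost J p η x + inner ℝ (∑ k, (grad (J k) x + η • grad (p k) x)) (y - x)
      + (∑ k, lmin k / 2) * ‖y - x‖ ^ 2 ≤ penalizedCost J p η y := by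
  have h : ∀ k, J k x + η * p k x + inner ℝ (grad (J k) x + η • grad (p k) x) (y - x)
      + lmin k / 2 * ‖y - x‖ ^ 2 ≤ J k y + η * p k y := fun k => by
    have h1 := (hreg.cost k).add_inner_add_sq_le (hreg.cost_ge k) x y
    have h2 := (hreg.pen k).add_inner_add_sq_le (hreg.pen_ge k) x y
    rw [zero_div, zero_mul, add_zero] at h2
    have h3 := mul_le_mul_of_nonneg_left h2 hη
    rw [inner_add_left, real_inner_smul_left]
    linarith
  have hs := Finset.sum_le_sum fun k (_ : k ∈ Finset.univ) => h k
  simp only [Finset.sum_add_distrib, ← Finset.mul_sum, ← Finset.sum_mul, ← sum_inner] at hs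
  simp only [penalizedCost, Finset.sum_add_distrib]
  exact hs

theorem NetworkRegularity.continuous_penalizedCost (hreg : NetworkRegularity J p lmin lmax lp)
    (η : ℝ) : Continuous (penalizedCost J p η) :=
  (continuous_finsetSum _ fun k _ => (hreg.cost k).continuous).add
    (continuous_const.mul (continuous_finsetSum _ fun k _ => (hreg.pen k).continuous))

theorem NetworkRegularity.sum_grad_eq_zero (hreg : NetworkRegularity J p lmin lmax lp) {η : ℝ}
    {z : EuclideanSpace ℝ (Fin M)} (hz : IsMinOn (penalizedCost J p η) Set.univ z) :
    ∑ k, (grad (J k) z + η • grad (p k) z) = 0 := by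
  let D := InnerProductSpace.toDual ℝ (EuclideanSpace ℝ (Fin M))
  have h1 : HasFDerivAt (penalizedCost J p η)
      (∑ k, D (grad (J k) z) + η • ∑ k, D (grad (p k) z)) z :=
    (HasFDerivAt.fun_sum fun k _ => ((hreg.cost k).hasGradientAt z).hasFDerivAt).add
      ((HasFDerivAt.fun_sum fun k _ => ((hreg.pen k).hasGradientAt z).hasFDerivAt).const_mul η)
  have h2 := (isMinOn_univ_iff.1 hz |> fun h => IsLocalMin.hasFDerivAt_eq_zero
    (Filter.Eventually.of_forall h) h1)
  have h3 : D (∑ k, (grad (J k) z + η • grad (p k) z)) = 0 := by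
    rw [← h2, map_sum]
    simp [Finset.sum_add_distrib, Finset.smul_sum]
  exact D.map_eq_zero_iff.1 h3

/-- Without feasibility the minimizer serves as its own reference point, with a bound that depends
on `η`. -/
theorem exists_referenceBound_self {η : ℝ} (hη : 0 < η) {wo : EuclideanSpace ℝ (Fin M)}
    (hopt : ∑ k, (grad (J k) wo + η • grad (p k) wo) = 0) :
    ∃ B, 0 ≤ B ∧ ReferenceBound J p η wo wo B := by
  obtain ⟨S₁, hS₁⟩ : ∃ y, y = ∑ k, (‖grad (J k) wo‖ + η * ‖grad (p k) wo‖) := ⟨_, rfl⟩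
  obtain ⟨S₂, hS₂⟩ : ∃ y, y = ∑ k, η * ‖grad (p k) wo‖ ^ 2 := ⟨_, rfl⟩
  have h₁ : ∀ k, ‖grad (J k) wo‖ + η * ‖grad (p k) wo‖ ≤ S₁ := fun k => hS₁ ▸
    Finset.single_le_sum (f := fun k => ‖grad (J k) wo‖ + η * ‖grad (p k) wo‖)
      (fun _ _ => by positivity) (Finset.mem_univ k)
  have h₂ : ∀ k, η * ‖grad (p k) wo‖ ^ 2 ≤ S₂ := fun k => hS₂ ▸
    Finset.single_le_sum (f := fun k => η * ‖grad (p k) wo‖ ^ 2)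
      (fun _ _ => by positivity) (Finset.mem_univ k)
  have hS₁0 : 0 ≤ S₁ := hS₁ ▸ Finset.sum_nonneg fun _ _ => by positivity
  have hS₂0 : 0 ≤ S₂ := hS₂ ▸ Finset.sum_nonneg fun _ _ => by positivity
  have hn := norm_nonneg wo
  have hB0 : 0 ≤ ‖wo‖ + S₁ + S₂ + 1 := by linarith
  refine ⟨‖wo‖ + S₁ + S₂ + 1, hB0, hopt, by linarith, by rwa [sub_self, norm_zero],
    fun k => (h₁ k).trans (by linarith), fun k => (h₂ k).trans ?_⟩
  -- the summand `1` makes the square dominate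
  calc S₂ ≤ ‖wo‖ + S₁ + S₂ + 1 := by linarith
    _ ≤ (‖wo‖ + S₁ + S₂ + 1) ^ 2 := le_self_pow₀ (by linarith) two_ne_zero

theorem aggregateCost_eq_penalizedCost (J p : K → EuclideanSpace ℝ (Fin M) → ℝ) :
    aggregateCost J = penalizedCost J p 0 := by
  funext w
  simp [aggregateCost, penalizedCost]

/-- Penalization only lowers the cost: the minimizer of the penalized cost is no more costly than a
feasible point, including its penalty. -/
theorem penalizedCost_le_of_feasible {ws : EuclideanSpace ℝ (Fin M)} (hws : ∀ k, p k ws = 0) {η : ℝ}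
    {wo : EuclideanSpace ℝ (Fin M)} (hmin : IsMinOn (penalizedCost J p η) Set.univ wo) :
    aggregateCost J wo + η * ∑ k, p k wo ≤ aggregateCost J ws := by
  have h := hmin (Set.mem_univ ws)
  simpa [penalizedCost, aggregateCost, hws] using h

variable [Nonempty K]

theorem NetworkRegularity.sum_lmin_pos (hreg : NetworkRegularity J p lmin lmax lp) :
    0 < ∑ k, lmin k / 2 :=
  Finset.sum_pos (fun k _ => half_pos (hreg.lmin_pos k)) Finset.univ_nonempty

theorem NetworkRegularity.exists_minimizer (hreg : NetworkRegularity J p lmin lmax lp) {η : ℝ}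
    (hη : 0 ≤ η) {s : Set (EuclideanSpace ℝ (Fin M))} (hs : IsClosed s) (hconv : Convex ℝ s)
    (hne : s.Nonempty) :
    ∃ z, ∀ y, (y ∈ s ∧ IsMinOn (penalizedCost J p η) s y) ↔ y = z :=
  existsUnique_isMinOn_of_quadratic_lower_bound hreg.sum_lmin_pos
    (hreg.continuous_penalizedCost η) (hreg.penalizedCost_lower_bound hη) hs hconv hne

section Feasible

variable {ws : EuclideanSpace ℝ (Fin M)}

theorem NetworkRegularity.norm_minimizer_sub_le (hreg : NetworkRegularity J p lmin lmax lp)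
    (hnn : ∀ k w, 0 ≤ p k w) (hws : ∀ k, p k ws = 0) {η : ℝ} (hη : 0 ≤ η)
    {wo : EuclideanSpace ℝ (Fin M)} (hmin : IsMinOn (penalizedCost J p η) Set.univ wo) :
    ‖wo - ws‖ ≤ ‖∑ k, grad (J k) ws‖ / ∑ k, lmin k / 2 := by
  have hc := hreg.sum_lmin_pos
  set c := ∑ k, lmin k / 2 with hcdef
  have h1 := hreg.penalizedCost_lower_bound hη ws wo
  simp only [hreg.grad_pen_eq_zero hnn hws, smul_zero, add_zero] at h1
  have h2 : penalizedCost J p η wo ≤ penalizedCost J p η ws := hmin (Set.mem_univ ws)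
  have h3 := neg_le_of_abs_le (abs_real_inner_le_norm (∑ k, grad (J k) ws) (wo - ws))
  rcases (norm_nonneg (wo - ws)).eq_or_lt with h4 | h4
  · rw [← h4]; exact div_nonneg (norm_nonneg _) hc.le
  rw [le_div_iff₀ hc]
  have h5 : ‖wo - ws‖ * (‖wo - ws‖ * c) ≤ ‖wo - ws‖ * ‖∑ k, grad (J k) ws‖ := by linarith
  exact le_of_mul_le_mul_left h5 h4

/-- For a feasible problem the reference bound is uniform in `η`. The gradients of the individual
penalties at the minimizer grow at most like `η ^ (-1/2)`: this follows from cocoercivity, tested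
against the feasible point, and the optimality condition. -/
theorem NetworkRegularity.exists_referenceBound_of_feasible
    (hreg : NetworkRegularity J p lmin lmax lp)
    (hnn : ∀ k w, 0 ≤ p k w) (hws : ∀ k, p k ws = 0) :
    ∃ B, 0 ≤ B ∧ ∀ η wo, 0 < η → IsMinOn (penalizedCost J p η) Set.univ wo →
      ReferenceBound J p η wo ws B := by
  obtain ⟨r, hr⟩ : ∃ y, y = ‖∑ k, grad (J k) ws‖ / ∑ k, lmin k / 2 := ⟨_, rfl⟩
  have hr0 : 0 ≤ r := hr ▸ div_nonneg (norm_nonneg _) hreg.sum_lmin_pos.le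
  obtain ⟨a, ha⟩ := Finite.exists_max lp
  obtain ⟨G, hG⟩ : ∃ y, y = ∑ k, (‖grad (J k) ws‖ + (lmin k + lmax k) * r) := ⟨_, rfl⟩
  have hl : ∀ k, 0 ≤ lmin k + lmax k := fun k => (add_pos (hreg.lmin_pos k) (hreg.lmax_pos k)).le
  have hG0 : 0 ≤ G := hG ▸ Finset.sum_nonneg fun k _ =>
    add_nonneg (norm_nonneg _) (mul_nonneg (hl k) hr0)
  have hP0 := (hreg.lp_pos a).le
  have hD0 : 0 ≤ lp a * (G * r) := by positivity
  refine ⟨‖ws‖ + r + G + lp a * (G * r) + 1, by positivity, fun η wo hη hmin => ?_⟩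
  have hn := norm_nonneg ws
  have hsub := hreg.norm_minimizer_sub_le hnn hws hη.le hmin
  rw [← hr] at hsub
  have hopt := hreg.sum_grad_eq_zero hmin
  refine ⟨hopt, by linarith, by linarith, fun k => ?_, fun k => ?_⟩
  · rw [hreg.grad_pen_eq_zero hnn hws, norm_zero, mul_zero, add_zero]
    have := Finset.single_le_sum (f := fun k => ‖grad (J k) ws‖ + (lmin k + lmax k) * r)
      (fun k _ => add_nonneg (norm_nonneg _) (mul_nonneg (hl k) hr0)) (Finset.mem_univ k)
    rw [← hG] at this
    linarith [mul_nonneg (hl k) hr0]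
  · have hin : ∀ k, 0 ≤ inner ℝ (grad (p k) wo) (wo - ws) := fun k => by
      have := (hreg.pen k).mul_sq_le_inner_grad_sub (hreg.pen_ge k) wo ws
      rwa [zero_mul, hreg.grad_pen_eq_zero hnn hws, sub_zero] at this
    have h1 : ‖grad (p k) wo‖ ^ 2 ≤ lp a * inner ℝ (grad (p k) wo) (wo - ws) := by
      have := (hreg.pen k).norm_grad_sub_sq_le (hreg.pen_ge k) (hreg.pen_le k) (hreg.lp_pos k) wo ws
      rw [hreg.grad_pen_eq_zero hnn hws, sub_zero] at this
      exact this.trans (mul_le_mul_of_nonneg_right (ha k) (hin k))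
    have h2 : inner ℝ (grad (p k) wo) (wo - ws) ≤ ∑ k, inner ℝ (grad (p k) wo) (wo - ws) :=
      Finset.single_le_sum (f := fun k => inner ℝ (grad (p k) wo) (wo - ws))
        (fun k _ => hin k) (Finset.mem_univ k)
    have h3 : η * ∑ k, inner ℝ (grad (p k) wo) (wo - ws)
        = -inner ℝ (∑ k, grad (J k) wo) (wo - ws) := by
      rw [Finset.sum_add_distrib, ← Finset.smul_sum, add_eq_zero_iff_eq_neg] at hopt
      rw [hopt, inner_neg_left, neg_neg, real_inner_smul_left, sum_inner]
    have h4 : ‖∑ k, grad (J k) wo‖ ≤ G := by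
      refine ((norm_sum_le _ _).trans (Finset.sum_le_sum fun k _ => ?_)).trans_eq hG.symm
      have e1 := norm_add_le (grad (J k) wo - grad (J k) ws) (grad (J k) ws)
      rw [sub_add_cancel] at e1
      have h0 := hreg.lmin_pos k
      have h0' := hreg.lmax_pos k
      have e2 := (hreg.cost k).norm_grad_sub_le (hreg.cost_ge k) (hreg.cost_le k)
        (c := lmin k + lmax k) (by rw [abs_of_pos h0]; linarith) (by rw [abs_of_pos h0']; linarith)
        wo ws
      have e3 := mul_le_mul_of_nonneg_left hsub (hl k)
      linarith
    have h5 : -inner ℝ (∑ k, grad (J k) wo) (wo - ws) ≤ G * r := by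
      have e1 := neg_le_of_abs_le (abs_real_inner_le_norm (∑ k, grad (J k) wo) (wo - ws))
      have e2 := mul_le_mul h4 hsub (norm_nonneg _) hG0
      linarith
    have h6 : η * ‖grad (p k) wo‖ ^ 2 ≤ lp a * (G * r) := by
      calc η * ‖grad (p k) wo‖ ^ 2 ≤ η * (lp a * inner ℝ (grad (p k) wo) (wo - ws)) :=
            mul_le_mul_of_nonneg_left h1 hη.le
        _ = lp a * (η * inner ℝ (grad (p k) wo) (wo - ws)) := by ring
        _ ≤ lp a * (η * ∑ k, inner ℝ (grad (p k) wo) (wo - ws)) :=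
            mul_le_mul_of_nonneg_left (mul_le_mul_of_nonneg_left h2 hη.le) hP0
        _ ≤ lp a * (G * r) := mul_le_mul_of_nonneg_left (h3 ▸ h5) hP0
    -- the summand `1` makes the square dominate
    calc η * ‖grad (p k) wo‖ ^ 2 ≤ ‖ws‖ + r + G + lp a * (G * r) + 1 := by linarith
      _ ≤ (‖ws‖ + r + G + lp a * (G * r) + 1) ^ 2 := le_self_pow₀ (by linarith) two_ne_zero

/-- As `η → ∞` the minimizers of the penalized cost converge to the solution `ws` of the constrained
problem: they stay in a ball, their penalties tend to zero and their costs are at most that of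
`ws`, so that `ws` is their only cluster point. -/
theorem NetworkRegularity.tendsto_minimizer (hreg : NetworkRegularity J p lmin lmax lp)
    (hnn : ∀ k w, 0 ≤ p k w) (hws : ∀ k, p k ws = 0)
    (huniq : ∀ y, (∀ k, p k y = 0) → aggregateCost J y ≤ aggregateCost J ws → y = ws)
    {wo : ℝ → EuclideanSpace ℝ (Fin M)}
    (hmin : ∀ η, 0 ≤ η → IsMinOn (penalizedCost J p η) Set.univ (wo η)) :
    Tendsto wo atTop (𝓝 ws) := by
  have hcontJ : Continuous (aggregateCost J) := by
    rw [aggregateCost_eq_penalizedCost J p]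
    exact hreg.continuous_penalizedCost 0
  have hcontp : Continuous fun w => ∑ k, p k w :=
    continuous_finsetSum _ fun k _ => (hreg.pen k).continuous
  have hpn : ∀ w, 0 ≤ ∑ k, p k w := fun w => Finset.sum_nonneg fun k _ => hnn k w
  set r := ‖∑ k, grad (J k) ws‖ / ∑ k, lmin k / 2 with hr
  have hmem : ∀ η, 0 ≤ η → wo η ∈ Metric.closedBall ws r := fun η hη => by
    rw [Metric.mem_closedBall, dist_eq_norm]
    exact hreg.norm_minimizer_sub_le hnn hws hη (hmin η hη)
  have hcost : ∀ η, 0 ≤ η → aggregateCost J (wo η) ≤ aggregateCost J ws := fun η hη => by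
    have := penalizedCost_le_of_feasible hws (hmin η hη)
    linarith [mul_nonneg hη (hpn (wo η))]
  -- the cost is bounded below by its value at the unconstrained minimizer
  have hlow : ∀ w, aggregateCost J (wo 0) ≤ aggregateCost J w := fun w => by
    rw [aggregateCost_eq_penalizedCost J p]
    exact hmin 0 le_rfl (Set.mem_univ w)
  refine (isCompact_closedBall ws r).tendsto_nhds_of_unique_mapClusterPt
    ((eventually_ge_atTop 0).mono hmem) fun y _ hy => ?_
  have hclosed : ∀ {s : Set (EuclideanSpace ℝ (Fin M))}, IsClosed s →
      (∀ᶠ η in atTop, wo η ∈ s) → y ∈ s := fun hs hev =>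
    hs.mem_of_mapClusterPt hy hev
  refine huniq y (fun k => ?_) ?_
  · have h0 : ∑ k, p k y ≤ 0 := by
      refine le_of_forall_pos_le_add fun ε hε => ?_
      rw [zero_add]
      refine hclosed (s := {w | ∑ k, p k w ≤ ε}) (isClosed_le hcontp continuous_const) ?_
      filter_upwards [eventually_gt_atTop 0,
        eventually_ge_atTop ((aggregateCost J ws - aggregateCost J (wo 0)) / ε)] with η h1 h2
      have h3 := penalizedCost_le_of_feasible hws (hmin η h1.le)
      have h4 := hlow (wo η)
      rw [div_le_iff₀ hε] at h2
      have h5 : η * ∑ k, p k (wo η) ≤ η * ε := by linarith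
      exact le_of_mul_le_mul_left h5 h1
    have h1 := le_antisymm h0 (hpn y)
    exact (Finset.sum_eq_zero_iff_of_nonneg fun k _ => hnn k y).1 h1 k (Finset.mem_univ k)
  · exact hclosed (s := {w | aggregateCost J w ≤ aggregateCost J ws})
      (isClosed_le hcontJ continuous_const) ((eventually_ge_atTop 0).mono hcost)

end Feasible

end Minimizers

/-! ### Small step-sizes -/

/-- With the penalty parameter `η = μ ^ (-θ)`, `θ < 1`, every small step-size lies below half of the
threshold, which itself depends on `η`. -/
theorem eventually_le_half_stepThreshold {K : Type*} [Fintype K] [Nonempty K]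
    {lmin lmax lp : K → ℝ} {α : ℝ} (hmin : ∀ k, 0 < lmin k) (hmax : ∀ k, 0 < lmax k)
    (hlp : ∀ k, 0 < lp k) (hα : 0 ≤ α) {η : ℝ → ℝ} (hη : ∀ μ, 0 < μ → 0 < η μ)
    (hlim : Tendsto (fun μ => η μ * μ) (𝓝[>] 0) (𝓝 0)) :
    ∀ᶠ μ in 𝓝[>] (0 : ℝ), μ ≤ 1 / 2 * stepThreshold lmin lmax lp α (η μ) := by
  have hid : Tendsto (fun μ : ℝ => μ) (𝓝[>] 0) (𝓝 0) := tendsto_id.mono_left nhdsWithin_le_nhds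
  have h1 : ∀ k, ∀ᶠ μ in 𝓝[>] (0 : ℝ), μ < lmax k / (lmax k ^ 2 + 2 * α) := fun k =>
    hid.eventually_lt_const (by have := hmax k; positivity)
  have h2 : ∀ k, ∀ᶠ μ in 𝓝[>] (0 : ℝ), μ < lmin k / (lmin k ^ 2 + 2 * α) := fun k =>
    hid.eventually_lt_const (by have := hmin k; positivity)
  have h3 : ∀ k, ∀ᶠ μ in 𝓝[>] (0 : ℝ), η μ * μ < 1 / lp k := fun k =>
    hlim.eventually_lt_const (by have := hlp k; positivity)
  filter_upwards [eventually_all.2 h1, eventually_all.2 h2, eventually_all.2 h3,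
    self_mem_nhdsWithin] with μ g1 g2 g3 g4
  have hημ := hη μ g4
  have h : 2 * μ ≤ stepThreshold lmin lmax lp α (η μ) := by
    refine Finset.le_inf' _ _ fun k _ => le_min ?_ (le_min ?_ ?_)
    · rw [mul_div_assoc]; exact mul_le_mul_of_nonneg_left (g1 k).le two_pos.le
    · rw [mul_div_assoc]; exact mul_le_mul_of_nonneg_left (g2 k).le two_pos.le
    · have hk := hlp k
      have h5 := (lt_div_iff₀ hk).1 (g3 k)
      rw [le_div_iff₀ (mul_pos hημ hk)]
      linarith
  linarith

theorem tendsto_ofReal_bound {a η : ℝ → ℝ} (C₁ C₂ : ℝ) (ha : Tendsto a (𝓝[>] 0) (𝓝 0))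
    (hlim : Tendsto (fun μ => η μ * μ) (𝓝[>] 0) (𝓝 0)) :
    Tendsto (fun μ => ENNReal.ofReal (4 * a μ ^ 2 + (C₁ * μ + C₂ * (η μ * μ) ^ 2)))
      (𝓝[>] 0) (𝓝 0) := by
  have hid : Tendsto (fun μ : ℝ => μ) (𝓝[>] 0) (𝓝 0) := tendsto_id.mono_left nhdsWithin_le_nhds
  have h := ENNReal.tendsto_ofReal
    (((ha.pow 2).const_mul 4).add ((hid.const_mul C₁).add ((hlim.pow 2).const_mul C₂)))
  simpa using h

theorem tendsto_rpow_neg_mul_self {θ : ℝ} (hθ : θ < 1) :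
    Tendsto (fun μ : ℝ => μ ^ (-θ) * μ) (𝓝[>] 0) (𝓝 0) := by
  have hid : Tendsto (fun μ : ℝ => μ) (𝓝[>] 0) (𝓝 0) := tendsto_id.mono_left nhdsWithin_le_nhds
  have h := hid.rpow_const (p := 1 - θ) (Or.inr (by linarith))
  rw [Real.zero_rpow (by linarith)] at h
  refine h.congr' ?_
  filter_upwards [self_mem_nhdsWithin] with μ hμ
  rw [sub_eq_neg_add, Real.rpow_add hμ, Real.rpow_one]

theorem theorem2 {K : Type*} [Fintype K] [DecidableEq K] [Nonempty K] {M : ℕ}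
    -- the costs, with Hessians bounded below and above
    (J : K → EuclideanSpace ℝ (Fin M) → ℝ) (lmin lmax : K → ℝ)
    (hlmin : ∀ k, 0 < lmin k) (hlmax : ∀ k, 0 < lmax k)
    (hJ : ∀ k, TwiceDifferentiable (J k))
    (hJmin : ∀ k, HessianGE (J k) (lmin k)) (hJmax : ∀ k, HessianLE (J k) (lmax k))
    -- the constraints and the penalties, with Hessians bounded above
    (L U : K → ℕ)
    (g : ∀ k, Fin (L k) → EuclideanSpace ℝ (Fin M) → ℝ)
    (hg : ∀ k l, ConvexOn ℝ Set.univ (g k l))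
    (h : ∀ k, Fin (U k) → EuclideanSpace ℝ (Fin M) →ᵃ[ℝ] ℝ)
    (δIP δEP : ℝ → ℝ) (hIP : IsInequalityPenalty δIP) (hEP : IsEqualityPenalty δEP)
    (p : K → EuclideanSpace ℝ (Fin M) → ℝ) (hp_def : ∀ k, p k = penalty δIP δEP (g k) (h k))
    (lp : K → ℝ) (hlp : ∀ k, 0 < lp k)
    (hp : ∀ k, TwiceDifferentiable (p k)) (hpmax : ∀ k, HessianLE (p k) (lp k))
    (W : Set (EuclideanSpace ℝ (Fin M))) (hW : W = ⋂ k, constraintSet (g k) (h k))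
    -- the combination matrix, in the ATC or the CTA form
    (A A₁ A₂ : Matrix K K ℝ) (hA : A ∈ doublyStochastic ℝ K) (hprim : A.IsPrimitive)
    (hform : (A₁ = 1 ∧ A₂ = A) ∨ (A₁ = A ∧ A₂ = 1))
    -- the parameters of the gradient noise
    (α σ : ℝ) (hα : 0 ≤ α) :
    -- `wo η` is the unique minimizer of the penalized aggregate cost
    ∃ wo : ℝ → EuclideanSpace ℝ (Fin M),
      (∀ η, 0 ≤ η → ∀ z, IsMinOn (penalizedCost J p η) Set.univ z ↔ z = wo η) ∧
      -- convergence below the threshold: the noise-free recursion converges to a fixed point that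
      -- does not depend on the initial point, and the stochastic one is mean-square stable
      (∀ η μ, 0 < η → 0 < μ → μ < stepThreshold lmin lmax lp α η →
        (∃ winf : K → EuclideanSpace ℝ (Fin M),
          diffusionStep J p A₁ A₂ μ η 0 winf = winf ∧
          ∀ x, Tendsto (fun i : ℕ => (diffusionStep J p A₁ A₂ μ η 0)^[i] x) atTop (𝓝 winf)) ∧
        ∀ (R : DiffusionRun.{u} J p A₁ A₂ α σ μ η) (k : K), R.limsupMSE (wo η) k < ∞) ∧
      -- the error bound for a fixed `η`, uniformly away from the threshold
      (∀ η, 0 < η → ∀ ρ, 0 < ρ → ρ < 1 → ∃ C₁ C₂ : ℝ,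
        ∀ μ, 0 < μ → μ ≤ ρ * stepThreshold lmin lmax lp α η →
        ∀ (R : DiffusionRun.{u} J p A₁ A₂ α σ μ η) (k : K),
          R.limsupMSE (wo η) k ≤ ENNReal.ofReal (C₁ * μ + C₂ * (η * μ) ^ 2)) ∧
      -- for a feasible problem, the constants do not depend on `η`
      (W.Nonempty → ∀ ρ, 0 < ρ → ρ < 1 → ∃ C₁ C₂ : ℝ,
        ∀ η μ, 0 < η → 0 < μ → μ ≤ ρ * stepThreshold lmin lmax lp α η →
        ∀ (R : DiffusionRun.{u} J p A₁ A₂ α σ μ η) (k : K),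
          R.limsupMSE (wo η) k ≤ ENNReal.ofReal (C₁ * μ + C₂ * (η * μ) ^ 2)) ∧
      -- the limit of small step-sizes for a fixed `η`
      (∀ η, 0 < η → ∀ (R : ∀ μ : ℝ, DiffusionRun.{u} J p A₁ A₂ α σ μ η) (k : K),
        Tendsto (fun μ => (R μ).limsupMSE (wo η) k) (𝓝[>] 0) (𝓝 0)) ∧
      -- for a feasible problem with its unique solution `ws`, and `η = μ ^ (-θ)`
      (W.Nonempty → ∃ ws : EuclideanSpace ℝ (Fin M),
        (∀ z, (z ∈ W ∧ IsMinOn (aggregateCost J) W z) ↔ z = ws) ∧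
        ∀ θ : ℝ, 0 < θ → θ < 1 →
        ∀ (R : ∀ μ : ℝ, DiffusionRun.{u} J p A₁ A₂ α σ μ (μ ^ (-θ))) (k : K),
          Tendsto (fun μ => (R μ).limsupMSE ws k) (𝓝[>] 0) (𝓝 0)) := by
  have hpen : ∀ k, (∀ w, 0 ≤ p k w) ∧ (∀ w, p k w = 0 ↔ w ∈ constraintSet (g k) (h k)) ∧
      ConvexOn ℝ Set.univ (p k) := fun k => by
    rw [hp_def k]
    exact ⟨penalty_nonneg hIP hEP, penalty_eq_zero_iff hIP hEP, convexOn_penalty hIP hEP (hg k)⟩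
  have hreg : NetworkRegularity J p lmin lmax lp :=
    ⟨hlmin, hlmax, hlp, hJ, hJmin, hJmax, hp, fun k => (hp k).hessianGE_zero (hpen k).2.2, hpmax⟩
  have hnn : ∀ k w, 0 ≤ p k w := fun k => (hpen k).1
  have hWp : ∀ w, w ∈ W ↔ ∀ k, p k w = 0 := fun w => by
    rw [hW, Set.mem_iInter]
    exact forall_congr' fun k => ((hpen k).2.1 w).symm
  have hex : ∀ η : ℝ, ∃ z, 0 ≤ η → ∀ y, IsMinOn (penalizedCost J p η) Set.univ y ↔ y = z := by
    intro η
    rcases le_or_gt 0 η with hη | hη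
    · obtain ⟨z, hz⟩ := hreg.exists_minimizer hη isClosed_univ convex_univ Set.univ_nonempty
      exact ⟨z, fun _ y => by simpa using hz y⟩
    · exact ⟨0, fun h => absurd h (not_le.2 hη)⟩
  choose wo hwo using hex
  have hmin : ∀ η, 0 ≤ η → IsMinOn (penalizedCost J p η) Set.univ (wo η) := fun η hη =>
    (hwo η hη (wo η)).2 rfl
  -- the error bound for a fixed penalty parameter
  have hfixed : ∀ η, 0 < η → ∀ ρ, 0 < ρ → ρ < 1 → ∃ C₁ C₂ : ℝ,
      ∀ μ, 0 < μ → μ ≤ ρ * stepThreshold lmin lmax lp α η →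
      ∀ (R : DiffusionRun.{u} J p A₁ A₂ α σ μ η) (k : K),
        R.limsupMSE (wo η) k ≤ ENNReal.ofReal (C₁ * μ + C₂ * (η * μ) ^ 2) := by
    intro η hη ρ hρ0 hρ1
    obtain ⟨B, hB, href⟩ := exists_referenceBound_self hη (hreg.sum_grad_eq_zero (hmin η hη.le))
    obtain ⟨C₁, C₂, hC⟩ := exists_limsupMSE_bound.{u} hreg hα hA hprim hform σ hρ0 hρ1 hB
    refine ⟨C₁, C₂, fun μ hμ hle R k => ?_⟩
    simpa using hC η μ (wo η) (wo η) hη hμ hle href R (wo η) k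
  -- the error bound for a feasible problem, for any target point
  have hfeas : W.Nonempty → ∀ ρ, 0 < ρ → ρ < 1 → ∃ C₁ C₂ : ℝ,
      ∀ η μ, 0 < η → 0 < μ → μ ≤ ρ * stepThreshold lmin lmax lp α η →
      ∀ (R : DiffusionRun.{u} J p A₁ A₂ α σ μ η) (x : EuclideanSpace ℝ (Fin M)) (k : K),
        R.limsupMSE x k
          ≤ ENNReal.ofReal (4 * ‖wo η - x‖ ^ 2 + (C₁ * μ + C₂ * (η * μ) ^ 2)) := by
    rintro ⟨ws, hws⟩ ρ hρ0 hρ1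
    obtain ⟨B, hB, href⟩ := hreg.exists_referenceBound_of_feasible hnn ((hWp ws).1 hws)
    obtain ⟨C₁, C₂, hC⟩ := exists_limsupMSE_bound.{u} hreg hα hA hprim hform σ hρ0 hρ1 hB
    exact ⟨C₁, C₂, fun η μ hη hμ hle => hC η μ (wo η) ws hη hμ hle
      (href η (wo η) hη (hmin η hη.le))⟩
  refine ⟨wo, hwo, fun η μ hη hμ hlt => ⟨?_, fun R k => ?_⟩, hfixed, fun hne ρ hρ0 hρ1 => ?_,
    fun η hη R k => ?_, fun hne => ?_⟩
  · -- the threshold of the noise-free recursion is at least that of the noisy one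
    have hT : 0 < stepThreshold lmin lmax lp α η := hμ.trans hlt
    obtain ⟨c, μ₀, hc, -, hrate⟩ := exists_contraction_rate hlmin hlmax hlp hα
      (div_pos hμ hT) ((div_lt_one hT).2 hlt)
    obtain ⟨-, hk⟩ := hrate η μ hη hμ (div_mul_cancel₀ _ hT.ne').ge
    have hs : 0 ≤ 2 * α * μ ^ 2 := by positivity
    have hcμ : 0 < c * μ := mul_pos hc hμ
    have hone : (1 : Matrix K K ℝ) ∈ doublyStochastic ℝ K := one_mem _
    have hA₁ : A₁ ∈ doublyStochastic ℝ K := by rcases hform with ⟨h, -⟩ | ⟨h, -⟩ <;> rwa [h]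
    have hA₂ : A₂ ∈ doublyStochastic ℝ K := by rcases hform with ⟨-, h⟩ | ⟨-, h⟩ <;> rwa [h]
    refine exists_fixedPoint_diffusionStep hA₁ hA₂ (Real.sqrt_nonneg (1 - c * μ)) ?_ fun k =>
      hreg.norm_adaptStep_sub_le hμ hη (Real.abs_le_sqrt (by linarith [(hk k).1]))
        (Real.abs_le_sqrt (by linarith [(hk k).2.1])) (hk k).2.2
    rw [Real.sqrt_lt' one_pos]
    linarith
  · have hT : 0 < stepThreshold lmin lmax lp α η := hμ.trans hlt
    obtain ⟨C₁, C₂, hC⟩ := hfixed η hη _ (div_pos hμ hT) ((div_lt_one hT).2 hlt)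
    exact (hC μ hμ (div_mul_cancel₀ _ hT.ne').ge R k).trans_lt ENNReal.ofReal_lt_top
  · obtain ⟨C₁, C₂, hC⟩ := hfeas hne ρ hρ0 hρ1
    exact ⟨C₁, C₂, fun η μ hη hμ hle R k => by simpa using hC η μ hη hμ hle R (wo η) k⟩
  · obtain ⟨C₁, C₂, hC⟩ := hfixed η hη (1 / 2) (by norm_num) (by norm_num)
    have hlim : Tendsto (fun μ : ℝ => η * μ) (𝓝[>] 0) (𝓝 0) := by
      simpa using (tendsto_id.mono_left nhdsWithin_le_nhds : Tendsto id (𝓝[>] (0 : ℝ)) (𝓝 0)).const_mul η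
    refine tendsto_of_tendsto_of_tendsto_of_le_of_le' tendsto_const_nhds
      (tendsto_ofReal_bound (a := fun _ => 0) C₁ C₂ tendsto_const_nhds hlim)
      (Eventually.of_forall fun _ => zero_le) ?_
    filter_upwards [eventually_le_half_stepThreshold hlmin hlmax hlp hα (fun _ _ => hη) hlim,
      self_mem_nhdsWithin] with μ hle hμ
    simpa using hC μ hμ hle (R μ) k
  · have hWclosed : IsClosed W := by
      have : W = ⋂ k, {w | p k w = 0} := by ext w; simp [hWp]
      rw [this]
      exact isClosed_iInter fun k => isClosed_eq (hp k).continuous continuous_const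
    have hWconv : Convex ℝ W := by
      have : W = ⋂ k, {w ∈ Set.univ | p k w ≤ 0} := by
        ext w
        simp only [hWp, Set.mem_iInter, Set.mem_univ, true_and]
        exact forall_congr' fun k => ⟨fun h => h.le, fun h => le_antisymm h (hnn k w)⟩
      rw [this]
      exact convex_iInter fun k => (hpen k).2.2.convex_le 0
    obtain ⟨ws, hws⟩ := hreg.exists_minimizer le_rfl hWclosed hWconv hne
    rw [← aggregateCost_eq_penalizedCost] at hws
    obtain ⟨hwsW, hwsmin⟩ := (hws ws).2 rfl
    have hlimwo : Tendsto wo atTop (𝓝 ws) :=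
      hreg.tendsto_minimizer hnn ((hWp ws).1 hwsW) (fun y hy hle => (hws y).1
        ⟨(hWp y).2 hy, fun z hz => hle.trans (hwsmin hz)⟩) hmin
    refine ⟨ws, hws, fun θ hθ0 hθ1 R k => ?_⟩
    obtain ⟨C₁, C₂, hC⟩ := hfeas hne (1 / 2) (by norm_num) (by norm_num)
    have hη : ∀ μ : ℝ, 0 < μ → 0 < μ ^ (-θ) := fun μ hμ => Real.rpow_pos_of_pos hμ _
    have hlim := tendsto_rpow_neg_mul_self hθ1
    have ha : Tendsto (fun μ : ℝ => ‖wo (μ ^ (-θ)) - ws‖) (𝓝[>] 0) (𝓝 0) :=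
      tendsto_iff_norm_sub_tendsto_zero.1
        (hlimwo.comp (tendsto_rpow_neg_nhdsGT_zero (by linarith)))
    refine tendsto_of_tendsto_of_tendsto_of_le_of_le' tendsto_const_nhds
      (tendsto_ofReal_bound C₁ C₂ ha hlim) (Eventually.of_forall fun _ => zero_le) ?_
    filter_upwards [eventually_le_half_stepThreshold hlmin hlmax hlp hα hη hlim,
      self_mem_nhdsWithin] with μ hle hμ
    exact hC _ μ (hη μ hμ) hμ hle (R μ) ws k
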